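/- For $k\ge 0$ let $A_k$ be the set of set partitions of $\{1,\dots,k,1',\dots,k'\}$, and for $k\ge1$ let $A_{k-\frac12}\subseteq A_k$ be the set of those partitions in which $k$ and $k'$ lie in the same block. The partition algebra $\mathcal{A}_k(z)$ is the free $\mathbb{Z}[z]$-module on $A_k$ with the bilinear product $\rho_1\rho_2=z^{\ell}\,\rho_1\circ\rho_2$, where $\rho_1\circ\rho_2$ is obtained by placing $\rho_1$ above $\rho_2$, identifying the bottom row of $\rho_1$ with the top row of $\rho_2$, and deleting the $\ell$ components that lie entirely in the middle row. Let $\mathcal{A}_{k-\frac12}(z)\subseteq\mathcal{A}_k(z)$ be the subalgebra generated by $A_{k-\frac12}$. For $m\le n$ regard $\mathcal{A}_m(z)\subseteq\mathcal{A}_n(z)$ by adding the blocks $\{j,j'\}$ for $m<j\le n$. Let $s_i$ be the partition with blocks $\{i,(i+1)'\},\{i+1,i'\}$ and $\{j,j'\}$ for $j\ne i,i+1$; let $p_i$ be the partition with blocks $\{i\},\{i'\}$ and $\{j,j'\}$ for $j\neq i$; let $p_{i+\frac12}$ be the partition with blocks $\{i,i+1,i',(i+1)'\}$ and $\{j,j'\}$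 for $j\ne i,i+1$. Define recursively $L_0=0$, $L_1=p_1$, $\sigma_1=1$, $\sigma_2=s_1$, $L_{\frac12}=0$, $\sigma_{\frac12}=\sigma_{1+\frac12}=1$; for $i\ge1$ $$L_{i+1}=-s_iL_ip_{i+\frac12}-p_{i+\frac12}L_is_i+p_{i+\frac12}L_ip_{i+1}p_{i+\frac12}+s_iL_is_i+\sigma_{i+1},$$ $$L_{i+\frac12}=-L_ip_{i+\frac12}-p_{i+\frac12}L_i+p_{i+\frac12}L_ip_ip_{i+\frac12}+s_iL_{i-\frac12}s_i+\sigma_{i+\frac12};$$ and for $i\ge2$ $$\begin{aligned}\sigma_{i+1}={}&s_{i-1}s_i\sigma_is_is_{i-1}+s_ip_{i-\frac12}L_{i-1}s_ip_{i-\frac12}s_i+p_{i-\frac12}L_{i-1}s_ip_{i-\frac12}\\&-s_ip_{i-\frac12}L_{i-1}s_{i-1}p_{i+\frac12}p_ip_{i-\frac12}-p_{i-\frac12}p_ip_{i+\frac12}s_{i-1}L_{i-1}p_{i-\frac12}s_i,\end{aligned}$$ $$\begin{aligned}\sigma_{i+\frac12}={}&s_{i-1}s_i\sigma_{i-\frac12}s_is_{i-1}+p_{i-\frac12}L_{i-1}s_ip_{i-\frac12}s_i+s_ip_{i-\frac12}L_{i-1}s_ip_{i-\frac12}\\&-p_{i-\frac12}L_{i-1}s_{i-1}p_{i+\frac12}p_ip_{i-\frac12}-s_ip_{i-\frac12}p_ip_{i+\frac12}s_{i-1}L_{i-1}p_{i-\frac12}s_i.\end{aligned}$$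 **Theorem.** For every $i\ge1$, and in every $\mathcal{A}_n(z)$ with $n\ge i+1$: 1. $L_{i+1}$ commutes with every element of $\mathcal{A}_{i+\frac12}(z)$, and $\sigma_{i+1}$ commutes with every element of $\mathcal{A}_{i-\frac12}(z)$; 2. $L_{i+\frac12}$ commutes with every element of $\mathcal{A}_i(z)$, and $\sigma_{i+\frac12}$ commutes with every element of $\mathcal{A}_{i-1}(z)$. Consequently the elements $L_i,L_{i+\frac12}$ $(i=0,1,2,\dots)$ commute pairwise (for each pair, in every $\mathcal{A}_n(z)$ containing both elements). -/

import Mathlib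

open Polynomial

namespace PartitionAlg

section Gluing

/-- The number of blocks of `r` that contain no vertex in the image of `i`. -/
noncomputable def missed {V U : Type} (r : Setoid V) (i : U → V) : ℕ :=
  (Set.range fun u => (Quotient.mk r (i u)))ᶜ.ncard

/-- The partition of top, middle and bottom vertices `X`, `Y`, `Z` into the connected components
of the picture obtained by placing `d` above `e` and identifying the bottom row of `d` with the
top row of `e`. -/
def stack {X Y Z : Type} (d : Setoid (X ⊕ Y)) (e : Setoid (Y ⊕ Z)) : Setoid (X ⊕ (Y ⊕ Z)) :=
  d.map (Sum.map id Sum.inl) ⊔ e.map Sum.inr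

/-- The top and bottom vertices among the vertices of the stacked picture. -/
def outer {X Y Z : Type} : X ⊕ Z → X ⊕ (Y ⊕ Z) := Sum.map id Sum.inr

/-- The composition `d ∘ e` of partitions: `d` on top of `e`, restricted to top and bottom row. -/
def comp {X Y Z : Type} (d : Setoid (X ⊕ Y)) (e : Setoid (Y ⊕ Z)) : Setoid (X ⊕ Z) :=
  (stack d e).comap outer

/-- The number of components contained in the middle row of the stacked picture. -/
noncomputable def loops {X Y Z : Type} (d : Setoid (X ⊕ Y)) (e : Setoid (Y ⊕ Z)) : ℕ :=
  missed (stack d e) outer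

/-- The identity partition, with blocks `{x, x'}`. -/
def idDiagram (X : Type) : Setoid (X ⊕ X) := Setoid.ker (Sum.elim id id)

theorem map_le_iff {P V : Type} {r : Setoid P} {f : P → V} {t : Setoid V} :
    r.map f ≤ t ↔ ∀ a b, r a b → t (f a) (f b) := by
  constructor
  · intro h a b hab
    exact h (Relation.EqvGen.rel _ _ ⟨a, b, hab, rfl, rfl⟩)
  · intro h
    refine Setoid.eqvGen_le ?_
    rintro _ _ ⟨a, b, hab, rfl, rfl⟩
    exact h a b hab

theorem missed_trans {V U W : Type} [Finite V] (r : Setoid V) (i : U → V) (j : W → U) :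
    missed r (i ∘ j) = missed r i + missed (r.comap i) j := by
  have hq : ∀ a b, (r.comap i) a b → r (i a) (i b) := fun a b h => h
  let q : Quotient (r.comap i) → Quotient r := Quotient.map i hq
  have hinj : Function.Injective q := by
    intro a b
    induction a using Quotient.inductionOn
    induction b using Quotient.inductionOn
    intro h
    exact Quotient.sound (show r _ _ from Quotient.exact h)
  unfold missed
  rw [← Set.ncard_image_of_injective _ hinj, ← Set.ncard_union_eq _ (Set.toFinite _) (Set.toFinite _)]
  · congr 1
    ext c
    simp only [Set.mem_compl_iff, Set.mem_range, Set.mem_union, Set.mem_image, Function.comp]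
    constructor
    · intro h
      by_cases hc : ∃ u, Quotient.mk r (i u) = c
      · right
        obtain ⟨u, rfl⟩ := hc
        refine ⟨Quotient.mk _ u, ?_, rfl⟩
        rintro ⟨w, hw⟩
        exact h ⟨w, congrArg q hw⟩
      · exact Or.inl hc
    · rintro (h | ⟨c', h, rfl⟩)
      · rintro ⟨w, hw⟩
        exact h ⟨_, hw⟩
      · rintro ⟨w, hw⟩
        exact h ⟨w, hinj hw⟩
  · rw [Set.disjoint_left]
    rintro c hc ⟨c', -, rfl⟩
    induction c' using Quotient.inductionOn with
    | _ u => exact hc ⟨u, rfl⟩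

section Eliminate

variable {P Q V U P' : Type} {r : Setoid P} {t : Setoid Q} {f : P → V} {g : Q → V}
  {i : U → V} {j : P' → P} {u : P' → U} {w : Q → U}

theorem exists_sep (hi : Function.Injective i) (hf : Function.Injective f)
    (hw : ∀ x, i (w x) = g x)
    (hfi : ∀ p a, f p = i a → ∃ q, p = j q ∧ a = u q) :
    ∃ F : V → Option (Quotient ((r.comap j).map u ⊔ t.map w) ⊕ Quotient r),
      (∀ a, F (i a) = some (Sum.inl (Quotient.mk _ a))) ∧
      (∀ p, (¬ ∃ q, r p (j q)) → F (f p) = some (Sum.inr (Quotient.mk _ p))) ∧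
      r.map f ⊔ t.map g ≤ Setoid.ker F := by
  classical
  set S := (r.comap j).map u ⊔ t.map w with hS
  have hSu : ∀ a b, r (j a) (j b) → S (u a) (u b) :=
    map_le_iff.1 (show (r.comap j).map u ≤ S from le_sup_left)
  have hSw : ∀ a b, t a b → S (w a) (w b) :=
    map_le_iff.1 (show t.map w ≤ S from le_sup_right)
  let G : P → Quotient S ⊕ Quotient r := fun p =>
    if h : ∃ q, r p (j q) then Sum.inl (Quotient.mk _ (u h.choose)) else Sum.inr (Quotient.mk _ p)
  have hG1 : ∀ p q, r p (j q) → G p = Sum.inl (Quotient.mk _ (u q)) := by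
    intro p q hpq
    have h : ∃ q, r p (j q) := ⟨q, hpq⟩
    simp only [G, dif_pos h]
    congr 1
    exact Quotient.sound (hSu _ _ (r.trans (r.symm h.choose_spec) hpq))
  have hG2 : ∀ p, (¬ ∃ q, r p (j q)) → G p = Sum.inr (Quotient.mk _ p) := fun p h => by
    simp only [G, dif_neg h]
  let F : V → Option (Quotient S ⊕ Quotient r) := fun v =>
    if h : ∃ a, i a = v then some (Sum.inl (Quotient.mk _ h.choose))
    else if h : ∃ p, f p = v then some (G h.choose) else none
  have hF1 : ∀ a, F (i a) = some (Sum.inl (Quotient.mk _ a)) := by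
    intro a
    have h : ∃ b, i b = i a := ⟨a, rfl⟩
    simp only [F, dif_pos h]
    rw [hi h.choose_spec]
  have hF2 : ∀ p, F (f p) = some (G p) := by
    intro p
    by_cases h : ∃ a, i a = f p
    · obtain ⟨a, ha⟩ := h
      obtain ⟨q, rfl, rfl⟩ := hfi p a ha.symm
      rw [← ha, hF1, hG1 _ q (r.refl _)]
    · have h' : ∃ p', f p' = f p := ⟨p, rfl⟩
      simp only [F, dif_neg h, dif_pos h']
      rw [hf h'.choose_spec]
  refine ⟨F, hF1, fun p hp => by rw [hF2, hG2 p hp], sup_le ?_ ?_⟩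
  · refine map_le_iff.2 fun a b hab => ?_
    rw [Setoid.ker_def, hF2, hF2]
    congr 1
    by_cases h : ∃ q, r b (j q)
    · obtain ⟨q, hq⟩ := h
      rw [hG1 b q hq, hG1 a q (r.trans hab hq)]
    · rw [hG2 b h, hG2 a fun ⟨q, hq⟩ => h ⟨q, r.trans (r.symm hab) hq⟩]
      congr 1
      exact Quotient.sound hab
  · refine map_le_iff.2 fun a b hab => ?_
    rw [Setoid.ker_def, ← hw, ← hw, hF1, hF1]
    congr 2
    exact Quotient.sound (hSw _ _ hab)

theorem comap_eliminate (hi : Function.Injective i) (hf : Function.Injective f)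
    (hu : ∀ q, i (u q) = f (j q)) (hw : ∀ x, i (w x) = g x)
    (hfi : ∀ p a, f p = i a → ∃ q, p = j q ∧ a = u q) :
    (r.map f ⊔ t.map g).comap i = (r.comap j).map u ⊔ t.map w := by
  obtain ⟨F, hF1, -, hF⟩ := exists_sep (r := r) (t := t) hi hf hw hfi
  apply le_antisymm
  · intro a b hab
    have h := hF hab
    rw [Setoid.ker_def, hF1, hF1] at h
    exact Quotient.exact (Sum.inl_injective (Option.some_injective _ h))
  · refine sup_le (map_le_iff.2 fun a b hab => ?_) (map_le_iff.2 fun a b hab => ?_)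
    · change (r.map f ⊔ t.map g) (i (u a)) (i (u b))
      rw [hu, hu]
      exact map_le_iff.1 (le_sup_left (a := r.map f)) _ _ hab
    · change (r.map f ⊔ t.map g) (i (w a)) (i (w b))
      rw [hw, hw]
      exact map_le_iff.1 (le_sup_right (b := t.map g)) _ _ hab

theorem missed_eliminate (hi : Function.Injective i) (hf : Function.Injective f)
    (hu : ∀ q, i (u q) = f (j q)) (hw : ∀ x, i (w x) = g x)
    (hfi : ∀ p a, f p = i a → ∃ q, p = j q ∧ a = u q)
    (hcov : ∀ v, (∃ a, i a = v) ∨ ∃ p, f p = v) :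
    missed (r.map f ⊔ t.map g) i = missed r j := by
  obtain ⟨F, hF1, hF2, hF⟩ := exists_sep (r := r) (t := t) hi hf hw hfi
  have hJ : ∀ a b, r a b → (r.map f ⊔ t.map g) (f a) (f b) :=
    map_le_iff.1 (le_sup_left (a := r.map f))
  let q : Quotient r → Quotient (r.map f ⊔ t.map g) := Quotient.map f hJ
  have hnot : ∀ p, Quotient.mk r p ∈ (Set.range fun x => Quotient.mk r (j x))ᶜ →
      ¬ ∃ x, r p (j x) := by
    rintro p hp ⟨x, hx⟩
    exact hp ⟨x, Quotient.sound (r.symm hx)⟩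
  have hinj : Set.InjOn q (Set.range fun x => Quotient.mk r (j x))ᶜ := by
    intro a ha b hb
    induction a using Quotient.inductionOn
    induction b using Quotient.inductionOn
    intro h
    have h' := hF (Quotient.exact h)
    rw [Setoid.ker_def, hF2 _ (hnot _ ha), hF2 _ (hnot _ hb)] at h'
    exact Sum.inr_injective (Option.some_injective _ h')
  unfold missed
  rw [← hinj.ncard_image]
  congr 1
  ext c
  constructor
  · intro hc
    induction c using Quotient.inductionOn with
    | _ v =>
    rcases hcov v with ⟨a, rfl⟩ | ⟨p, rfl⟩
    · exact absurd ⟨a, rfl⟩ hc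
    · refine ⟨Quotient.mk _ p, ?_, rfl⟩
      rintro ⟨x, hx⟩
      refine hc ⟨u x, ?_⟩
      change Quotient.mk _ (i (u x)) = _
      rw [hu]
      exact Quotient.sound (hJ _ _ (Quotient.exact hx))
  · rintro ⟨c', hc', rfl⟩
    induction c' using Quotient.inductionOn with
    | _ p =>
    rintro ⟨a, ha⟩
    have h' := hF (Quotient.exact ha)
    rw [Setoid.ker_def, hF1, hF2 _ (hnot _ hc')] at h'
    simp at h'

end Eliminate

theorem map_sup' {P V : Type} (r t : Setoid P) (f : P → V) :
    (r ⊔ t).map f = r.map f ⊔ t.map f := by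
  apply le_antisymm
  · refine map_le_iff.2 fun a b hab => ?_
    have : r ⊔ t ≤ (r.map f ⊔ t.map f).comap f :=
      sup_le (fun a b h => map_le_iff.1 (le_sup_left (a := r.map f)) _ _ h)
        (fun a b h => map_le_iff.1 (le_sup_right (b := t.map f)) _ _ h)
    exact this hab
  · exact sup_le (map_le_iff.2 fun a b h => map_le_iff.1 le_rfl _ _ (Setoid.le_def.1 le_sup_left h))
      (map_le_iff.2 fun a b h => map_le_iff.1 le_rfl _ _ (Setoid.le_def.1 le_sup_right h))

theorem map_map' {P V W : Type} (r : Setoid P) (f : P → V) (g : V → W) :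
    (r.map f).map g = r.map (g ∘ f) := by
  apply le_antisymm
  · refine map_le_iff.2 fun a b hab => ?_
    have : r.map f ≤ (r.map (g ∘ f)).comap g :=
      map_le_iff.2 fun a b h => map_le_iff.1 (le_refl (r.map (g ∘ f))) _ _ h
    exact this hab
  · exact map_le_iff.2 fun a b h =>
      map_le_iff.1 (le_refl ((r.map f).map g)) _ _ (map_le_iff.1 (le_refl (r.map f)) _ _ h)

section Assoc

variable {X Y Z W : Type}

/-- Four rows: the components of the picture of three stacked partitions. -/
def stack₃ (d : Setoid (X ⊕ Y)) (e : Setoid (Y ⊕ Z)) (c : Setoid (Z ⊕ W)) :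
    Setoid (X ⊕ (Y ⊕ (Z ⊕ W))) :=
  d.map (Sum.map id Sum.inl) ⊔ e.map (fun v => Sum.inr (Sum.map id Sum.inl v)) ⊔
    c.map (fun v => Sum.inr (Sum.inr v))

theorem stack₃_eq_left (d : Setoid (X ⊕ Y)) (e : Setoid (Y ⊕ Z)) (c : Setoid (Z ⊕ W)) :
    stack₃ d e c = (stack d e).map (Sum.map id (Sum.map id Sum.inl)) ⊔
      c.map (fun v => Sum.inr (Sum.inr v)) := by
  rw [stack, map_sup', map_map', map_map', stack₃]
  have h1 : (Sum.map id (Sum.map id Sum.inl) : X ⊕ (Y ⊕ Z) → X ⊕ (Y ⊕ (Z ⊕ W))) ∘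
      (Sum.map id Sum.inl : X ⊕ Y → X ⊕ (Y ⊕ Z)) = Sum.map id Sum.inl := by
    funext v
    rcases v with v | v <;> rfl
  rw [h1]
  rfl

theorem stack₃_eq_right (d : Setoid (X ⊕ Y)) (e : Setoid (Y ⊕ Z)) (c : Setoid (Z ⊕ W)) :
    stack₃ d e c = (stack e c).map Sum.inr ⊔ d.map (Sum.map id Sum.inl) := by
  rw [stack, map_sup', map_map', map_map', stack₃, sup_assoc, sup_comm]
  rfl

theorem comap_left (d : Setoid (X ⊕ Y)) (e : Setoid (Y ⊕ Z)) (c : Setoid (Z ⊕ W)) :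
    (stack₃ d e c).comap (Sum.map id Sum.inr) = stack (comp d e) c ∧
      missed (stack₃ d e c) (Sum.map id Sum.inr : X ⊕ (Z ⊕ W) → _) = loops d e := by
  rw [stack₃_eq_left]
  have hi : Function.Injective (Sum.map id Sum.inr : X ⊕ (Z ⊕ W) → X ⊕ (Y ⊕ (Z ⊕ W))) :=
    Sum.map_injective.2 ⟨Function.injective_id, Sum.inr_injective⟩
  have hf : Function.Injective
      (Sum.map id (Sum.map id Sum.inl) : X ⊕ (Y ⊕ Z) → X ⊕ (Y ⊕ (Z ⊕ W))) :=
    Sum.map_injective.2 ⟨Function.injective_id,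
      Sum.map_injective.2 ⟨Function.injective_id, Sum.inl_injective⟩⟩
  have hu : ∀ q : X ⊕ Z, (Sum.map id Sum.inr : X ⊕ (Z ⊕ W) → X ⊕ (Y ⊕ (Z ⊕ W)))
      (Sum.map id Sum.inl q) = Sum.map id (Sum.map id Sum.inl) (outer q) := by
    rintro (q | q) <;> rfl
  have hfi : ∀ (p : X ⊕ (Y ⊕ Z)) (a : X ⊕ (Z ⊕ W)),
      (Sum.map id (Sum.map id Sum.inl) p : X ⊕ (Y ⊕ (Z ⊕ W))) = Sum.map id Sum.inr a →
        ∃ q : X ⊕ Z, p = outer q ∧ a = Sum.map id Sum.inl q := by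
    rintro (p | p | p) (a | a | a) h <;> simp at h
    · subst h; exact ⟨Sum.inl p, rfl, rfl⟩
    · subst h; exact ⟨Sum.inr p, rfl, rfl⟩
  refine ⟨comap_eliminate (w := Sum.inr) hi hf hu (fun _ => rfl) hfi,
    missed_eliminate (w := Sum.inr) hi hf hu (fun _ => rfl) hfi ?_⟩
  rintro (v | v | v | v)
  · exact Or.inl ⟨Sum.inl v, rfl⟩
  · exact Or.inr ⟨Sum.inr (Sum.inl v), rfl⟩
  · exact Or.inl ⟨Sum.inr (Sum.inl v), rfl⟩
  · exact Or.inl ⟨Sum.inr (Sum.inr v), rfl⟩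

theorem comap_right (d : Setoid (X ⊕ Y)) (e : Setoid (Y ⊕ Z)) (c : Setoid (Z ⊕ W)) :
    (stack₃ d e c).comap (Sum.map id (Sum.map id Sum.inr)) = stack d (comp e c) ∧
      missed (stack₃ d e c) (Sum.map id (Sum.map id Sum.inr) : X ⊕ (Y ⊕ W) → _) = loops e c := by
  rw [stack₃_eq_right]
  have hi : Function.Injective
      (Sum.map id (Sum.map id Sum.inr) : X ⊕ (Y ⊕ W) → X ⊕ (Y ⊕ (Z ⊕ W))) :=
    Sum.map_injective.2 ⟨Function.injective_id,
      Sum.map_injective.2 ⟨Function.injective_id, Sum.inr_injective⟩⟩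
  have hf : Function.Injective (Sum.inr : Y ⊕ (Z ⊕ W) → X ⊕ (Y ⊕ (Z ⊕ W))) := Sum.inr_injective
  have hu : ∀ q : Y ⊕ W, (Sum.map id (Sum.map id Sum.inr) : X ⊕ (Y ⊕ W) → X ⊕ (Y ⊕ (Z ⊕ W)))
      (Sum.inr q) = Sum.inr (outer q) := by
    rintro (q | q) <;> rfl
  have hw : ∀ x : X ⊕ Y, (Sum.map id (Sum.map id Sum.inr) : X ⊕ (Y ⊕ W) → X ⊕ (Y ⊕ (Z ⊕ W)))
      (Sum.map id Sum.inl x) = Sum.map id Sum.inl x := by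
    rintro (q | q) <;> rfl
  have hfi : ∀ (p : Y ⊕ (Z ⊕ W)) (a : X ⊕ (Y ⊕ W)),
      (Sum.inr p : X ⊕ (Y ⊕ (Z ⊕ W))) = Sum.map id (Sum.map id Sum.inr) a →
        ∃ q : Y ⊕ W, p = outer q ∧ a = Sum.inr q := by
    rintro (p | p | p) (a | a | a) h <;> simp at h
    · subst h; exact ⟨Sum.inl p, rfl, rfl⟩
    · subst h; exact ⟨Sum.inr p, rfl, rfl⟩
  refine ⟨?_, missed_eliminate (w := Sum.map id Sum.inl) hi hf hu hw hfi ?_⟩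
  · rw [comap_eliminate (w := Sum.map id Sum.inl) hi hf hu hw hfi, sup_comm]
    rfl
  rintro (v | v | v | v)
  · exact Or.inl ⟨Sum.inl v, rfl⟩
  · exact Or.inl ⟨Sum.inr (Sum.inl v), rfl⟩
  · exact Or.inr ⟨Sum.inr (Sum.inl v), rfl⟩
  · exact Or.inl ⟨Sum.inr (Sum.inr v), rfl⟩

theorem comp_assoc (d : Setoid (X ⊕ Y)) (e : Setoid (Y ⊕ Z)) (c : Setoid (Z ⊕ W)) :
    comp (comp d e) c = comp d (comp e c) := by
  rw [comp, ← (comap_left d e c).1, comp.eq_1 d, ← (comap_right d e c).1]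
  have h : (Sum.map id Sum.inr ∘ outer : X ⊕ W → X ⊕ (Y ⊕ (Z ⊕ W))) =
      Sum.map id (Sum.map id Sum.inr) ∘ outer := by
    funext v
    rcases v with v | v <;> rfl
  exact congrArg (fun t => (stack₃ d e c).comap t) h

theorem loops_assoc [Finite X] [Finite Y] [Finite Z] [Finite W]
    (d : Setoid (X ⊕ Y)) (e : Setoid (Y ⊕ Z)) (c : Setoid (Z ⊕ W)) :
    loops d e + loops (comp d e) c = loops e c + loops d (comp e c) := by
  rw [← (comap_left d e c).2, ← (comap_right d e c).2, loops, loops, ← (comap_left d e c).1,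
    ← (comap_right d e c).1, ← missed_trans, ← missed_trans]
  congr 1
  ext v
  rcases v with v | v <;> rfl

theorem missed_of_surj {V U : Type} (r : Setoid V) (i : U → V) (h : ∀ v, ∃ a, r (i a) v) :
    missed r i = 0 := by
  unfold missed
  rw [Set.compl_empty_iff.2, Set.ncard_empty]
  ext c
  induction c using Quotient.inductionOn with
  | _ v =>
  obtain ⟨a, ha⟩ := h v
  simp only [Set.mem_range, Set.mem_univ, iff_true]
  exact ⟨a, Quotient.sound ha⟩

theorem stack_rel_left (d : Setoid (X ⊕ Y)) (e : Setoid (Y ⊕ Z)) {a b : X ⊕ Y} (h : d a b) :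
    stack d e (Sum.map id Sum.inl a) (Sum.map id Sum.inl b) :=
  map_le_iff.1 (le_sup_left (a := d.map (Sum.map id Sum.inl))) _ _ h

theorem stack_rel_right (d : Setoid (X ⊕ Y)) (e : Setoid (Y ⊕ Z)) {a b : Y ⊕ Z} (h : e a b) :
    stack d e (Sum.inr a) (Sum.inr b) :=
  map_le_iff.1 (le_sup_right (b := e.map Sum.inr)) _ _ h

theorem id_comp (d : Setoid (X ⊕ Y)) : comp (idDiagram X) d = d := by
  apply le_antisymm
  · have h : stack (idDiagram X) d ≤ d.comap (Sum.elim Sum.inl id) := by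
      refine sup_le (map_le_iff.2 ?_) (map_le_iff.2 fun a b h => h)
      rintro (a | a) (b | b) h <;> obtain rfl : a = b := h <;> exact d.refl _
    intro a b hab
    have := h hab
    rcases a with a | a <;> rcases b with b | b <;> exact this
  · have key : ∀ a : X ⊕ Y, stack (idDiagram X) d (outer a) (Sum.inr a) := by
      rintro (a | a)
      · exact stack_rel_left (idDiagram X) d (a := Sum.inl a) (b := Sum.inr a) rfl
      · exact Setoid.refl' _ _
    intro a b hab
    change stack _ _ (outer a) (outer b)
    exact Setoid.trans' _ (key a) (Setoid.trans' _ (stack_rel_right _ _ hab)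
      (Setoid.symm' _ (key b)))

theorem comp_id (d : Setoid (X ⊕ Y)) : comp d (idDiagram Y) = d := by
  apply le_antisymm
  · have h : stack d (idDiagram Y) ≤ d.comap (Sum.elim Sum.inl (Sum.elim Sum.inr Sum.inr)) := by
      refine sup_le (map_le_iff.2 ?_) (map_le_iff.2 ?_)
      · rintro (a | a) (b | b) h <;> exact h
      · rintro (a | a) (b | b) h <;> obtain rfl : a = b := h <;> exact d.refl _
    intro a b hab
    have := h hab
    rcases a with a | a <;> rcases b with b | b <;> exact this
  · have key : ∀ a : X ⊕ Y, stack d (idDiagram Y) (outer a) (Sum.map id Sum.inl a) := by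
      rintro (a | a)
      · exact Setoid.refl' _ _
      · exact stack_rel_right d (idDiagram Y) (a := Sum.inr a) (b := Sum.inl a) rfl
    intro a b hab
    change stack _ _ (outer a) (outer b)
    exact Setoid.trans' _ (key a) (Setoid.trans' _ (stack_rel_left _ _ hab)
      (Setoid.symm' _ (key b)))

theorem loops_id_left (d : Setoid (X ⊕ Y)) : loops (idDiagram X) d = 0 := by
  refine missed_of_surj _ _ ?_
  rintro (v | v | v)
  · exact ⟨Sum.inl v, Setoid.refl' _ _⟩
  · exact ⟨Sum.inl v, stack_rel_left (idDiagram X) d (a := Sum.inl v) (b := Sum.inr v) rfl⟩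
  · exact ⟨Sum.inr v, Setoid.refl' _ _⟩

theorem loops_id_right (d : Setoid (X ⊕ Y)) : loops d (idDiagram Y) = 0 := by
  refine missed_of_surj _ _ ?_
  rintro (v | v | v)
  · exact ⟨Sum.inl v, Setoid.refl' _ _⟩
  · exact ⟨Sum.inr v, stack_rel_right d (idDiagram Y) (a := Sum.inr v) (b := Sum.inl v) rfl⟩
  · exact ⟨Sum.inr v, Setoid.refl' _ _⟩

end Assoc

end Gluing

section Algebra

/-- `A_k`: the set partitions of `{1, …, k, 1', …, k'}`, encoded as equivalence relations. The
vertex `j` of the top row is `Sum.inl a` and the vertex `j'` of the bottom row is `Sum.inr a`,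
where `a : Fin k` has value `j - 1`. -/
abbrev Diagram (k : ℕ) : Type := Setoid (Fin k ⊕ Fin k)

/-- The partition algebra `𝒜_k(z)`: the `ℤ[z]`-module freely generated by `A_k`. -/
def PartitionAlgebra (k : ℕ) : Type := Diagram k →₀ ℤ[X]

namespace PartitionAlgebra

variable {k : ℕ}

noncomputable instance : AddCommGroup (PartitionAlgebra k) :=
  inferInstanceAs (AddCommGroup (Diagram k →₀ ℤ[X]))

noncomputable instance : Module ℤ[X] (PartitionAlgebra k) :=
  inferInstanceAs (Module ℤ[X] (Diagram k →₀ ℤ[X]))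

/-- The multiple `c • d` of a basis element. -/
noncomputable def single (d : Diagram k) (c : ℤ[X]) : PartitionAlgebra k := Finsupp.single d c

/-- The basis element given by a set partition. -/
noncomputable def ofDiagram (d : Diagram k) : PartitionAlgebra k := single d 1

/-- Left multiplication by the basis element `d`, determined by `d * e = z ^ ℓ • (d ∘ e)` on set
partitions, where `ℓ` is the number of components removed from the middle row. -/
noncomputable def mulDiagram (d : Diagram k) : PartitionAlgebra k →ₗ[ℤ[X]] PartitionAlgebra k :=
  Finsupp.linearCombination ℤ[X] fun e : Diagram k =>
    (X ^ loops d e : ℤ[X]) • ofDiagram (comp d e)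

/-- The bilinear product of the partition algebra. -/
noncomputable def mulMap :
    PartitionAlgebra k →ₗ[ℤ[X]] PartitionAlgebra k →ₗ[ℤ[X]] PartitionAlgebra k :=
  Finsupp.linearCombination ℤ[X] mulDiagram

noncomputable instance : Mul (PartitionAlgebra k) := ⟨fun a b => mulMap a b⟩

noncomputable instance : One (PartitionAlgebra k) := ⟨ofDiagram (idDiagram (Fin k))⟩

theorem mul_def (a b : PartitionAlgebra k) : a * b = mulMap a b := rfl

theorem smul_single (r c : ℤ[X]) (d : Diagram k) : r • single d c = single d (r * c) :=
  Finsupp.smul_single' r d c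

theorem single_mul_single (d e : Diagram k) (r s : ℤ[X]) :
    single d r * single e s = single (comp d e) (r * s * X ^ loops d e) := by
  have h : single d r * single e s
      = r • (s • ((X ^ loops d e : ℤ[X]) • ofDiagram (comp d e))) := by
    have h1 : mulMap (single d r) = r • mulDiagram d :=
      Finsupp.linearCombination_single ℤ[X] r d
    have h2 : mulDiagram d (single e s) = s • ((X ^ loops d e : ℤ[X]) • ofDiagram (comp d e)) :=
      Finsupp.linearCombination_single ℤ[X] s e
    rw [mul_def, h1, LinearMap.smul_apply, h2]
  rw [h, ofDiagram, smul_single, smul_single, smul_single]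
  congr 1
  ring

theorem ofDiagram_mul_ofDiagram (d e : Diagram k) :
    ofDiagram d * ofDiagram e = (X ^ loops d e : ℤ[X]) • ofDiagram (comp d e) := by
  rw [ofDiagram, ofDiagram, single_mul_single, ofDiagram, smul_single]
  congr 1
  ring

@[elab_as_elim]
theorem induction_on {p : PartitionAlgebra k → Prop} (a : PartitionAlgebra k)
    (h0 : p 0) (hadd : ∀ a b, p a → p b → p (a + b)) (hs : ∀ d r, p (single d r)) : p a :=
  Finsupp.induction_linear a h0 hadd hs

theorem add_mul' (a b c : PartitionAlgebra k) : (a + b) * c = a * c + b * c := by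
  simp only [mul_def, map_add, LinearMap.add_apply]

theorem mul_add' (a b c : PartitionAlgebra k) : a * (b + c) = a * b + a * c := by
  simp only [mul_def, map_add]

theorem zero_mul' (a : PartitionAlgebra k) : 0 * a = 0 := by
  simp only [mul_def, map_zero, LinearMap.zero_apply]

theorem mul_zero' (a : PartitionAlgebra k) : a * 0 = 0 := by
  simp only [mul_def, map_zero]

theorem mul_assoc' (a b c : PartitionAlgebra k) : a * b * c = a * (b * c) := by
  induction a using induction_on with
  | h0 => simp only [zero_mul']
  | hadd a a' h h' => simp only [add_mul', h, h']
  | hs d r =>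
  induction b using induction_on with
  | h0 => simp only [zero_mul', mul_zero']
  | hadd a a' h h' => simp only [add_mul', mul_add', h, h']
  | hs e s =>
  induction c using induction_on with
  | h0 => simp only [mul_zero']
  | hadd a a' h h' => simp only [mul_add', h, h']
  | hs f t =>
  rw [single_mul_single, single_mul_single, single_mul_single, single_mul_single, comp_assoc]
  congr 1
  have h : (X : ℤ[X]) ^ loops d e * X ^ loops (comp d e) f
      = X ^ loops e f * X ^ loops d (comp e f) := by
    rw [← pow_add, ← pow_add, loops_assoc]
  linear_combination (r * s * t) * h

theorem one_mul' (a : PartitionAlgebra k) : 1 * a = a := by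
  induction a using induction_on with
  | h0 => exact mul_zero' _
  | hadd a a' h h' => rw [mul_add', h, h']
  | hs d r =>
  change single _ 1 * single d r = single d r
  rw [single_mul_single, id_comp, loops_id_left, pow_zero, one_mul, mul_one]

theorem mul_one' (a : PartitionAlgebra k) : a * 1 = a := by
  induction a using induction_on with
  | h0 => exact zero_mul' _
  | hadd a a' h h' => rw [add_mul', h, h']
  | hs d r =>
  change single d r * single _ 1 = single d r
  rw [single_mul_single, comp_id, loops_id_right, pow_zero, mul_one, mul_one]

noncomputable instance : Ring (PartitionAlgebra k) :=
  { (inferInstance : AddCommGroup (PartitionAlgebra k)),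
    (inferInstance : Mul (PartitionAlgebra k)),
    (inferInstance : One (PartitionAlgebra k)) with
    left_distrib := mul_add'
    right_distrib := add_mul'
    zero_mul := zero_mul'
    mul_zero := mul_zero'
    mul_assoc := mul_assoc'
    one_mul := one_mul'
    mul_one := mul_one' }

noncomputable instance : Algebra ℤ[X] (PartitionAlgebra k) :=
  Algebra.ofModule
    (fun r a b => by simp only [mul_def, map_smul, LinearMap.smul_apply])
    (fun r a b => by simp only [mul_def, map_smul])

end PartitionAlgebra

end Algebra

section Tower

open PartitionAlgebra

/-- The inclusion `A_m ⊆ A_n` for `m ≤ n`, adding the blocks `{j, j'}` for `m < j ≤ n`. -/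
abbrev Diagram.extend {m : ℕ} (n : ℕ) (d : Diagram m) : Diagram n :=
  Setoid.ker (Sum.elim
    (fun a : Fin n => if h : (a : ℕ) < m then Sum.inl (Quotient.mk d (Sum.inl ⟨a, h⟩))
      else Sum.inr (a : ℕ))
    (fun a : Fin n => if h : (a : ℕ) < m then Sum.inl (Quotient.mk d (Sum.inr ⟨a, h⟩))
      else Sum.inr (a : ℕ)))

/-- The algebra `𝒜_m(z)` as a subalgebra of `𝒜_n(z)`, where `m ≤ n`. -/
noncomputable def subalg (n m : ℕ) : Subalgebra ℤ[X] (PartitionAlgebra n) :=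
  Algebra.adjoin ℤ[X] (Set.range fun d : Diagram m => ofDiagram (d.extend n))

/-- The algebra `𝒜_{m + 1/2}(z)` as a subalgebra of `𝒜_n(z)`, where `m + 1 ≤ n`: it is generated
by the elements of `A_{m + 1/2}`, the partitions in `A_{m + 1}` with `m + 1` and `(m + 1)'` in the
same block. -/
noncomputable def subalgHalf (n m : ℕ) : Subalgebra ℤ[X] (PartitionAlgebra n) :=
  Algebra.adjoin ℤ[X] ((fun d : Diagram (m + 1) => ofDiagram (d.extend n)) ''
    {d | d (Sum.inl (Fin.last m)) (Sum.inr (Fin.last m))})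

end Tower

section JucysMurphy

open PartitionAlgebra

/-- The label in `{1, …, n}` of a vertex. -/
def label {n : ℕ} (a : Fin n) : ℕ := a + 1

/-- The generator `s_i` of `𝒜_n(z)`, for `1 ≤ i < n`: the blocks are `{i, (i+1)'}`, `{i+1, i'}`
and `{j, j'}` for `j ≠ i, i + 1`. -/
noncomputable def s (n i : ℕ) : PartitionAlgebra n :=
  ofDiagram (Setoid.ker (Sum.elim (fun a : Fin n => Equiv.swap i (i + 1) (label a)) label))

/-- The generator `p_i` of `𝒜_n(z)`, for `1 ≤ i ≤ n`: the blocks are `{i}`, `{i'}` and `{j, j'}`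
for `j ≠ i`. (The bottom vertex `i'` is given the unused label `0`.) -/
noncomputable def p (n i : ℕ) : PartitionAlgebra n :=
  ofDiagram (Setoid.ker (Sum.elim label fun a : Fin n => if label a = i then 0 else label a))

/-- The generator `p_{i + 1/2}` of `𝒜_n(z)`, for `1 ≤ i < n`: the blocks are
`{i, i+1, i', (i+1)'}` and `{j, j'}` for `j ≠ i, i + 1`. -/
noncomputable def pHalf (n i : ℕ) : PartitionAlgebra n :=
  let f : Fin n → ℕ := fun a => if label a = i + 1 then i else label a
  ofDiagram (Setoid.ker (Sum.elim f f))

mutual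

/-- The element `L_i` of `𝒜_n(z)`, for `i ≤ n`. -/
noncomputable def L (n : ℕ) : ℕ → PartitionAlgebra n
  | 0 => 0
  | 1 => p n 1
  | i + 2 =>
    -(s n (i + 1) * L n (i + 1) * pHalf n (i + 1))
      - pHalf n (i + 1) * L n (i + 1) * s n (i + 1)
      + pHalf n (i + 1) * L n (i + 1) * p n (i + 2) * pHalf n (i + 1)
      + s n (i + 1) * L n (i + 1) * s n (i + 1)
      + sigmaSucc n (i + 1)

/-- The element `σ_{i + 1}` of `𝒜_n(z)`, for `i + 1 ≤ n`. -/
noncomputable def sigmaSucc (n : ℕ) : ℕ → PartitionAlgebra n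
  | 0 => 1
  | 1 => s n 1
  | i + 2 =>
    s n (i + 1) * s n (i + 2) * sigmaSucc n (i + 1) * s n (i + 2) * s n (i + 1)
      + s n (i + 2) * pHalf n (i + 1) * L n (i + 1) * s n (i + 2) * pHalf n (i + 1) * s n (i + 2)
      + pHalf n (i + 1) * L n (i + 1) * s n (i + 2) * pHalf n (i + 1)
      - s n (i + 2) * pHalf n (i + 1) * L n (i + 1) * s n (i + 1) * pHalf n (i + 2) * p n (i + 2)
        * pHalf n (i + 1)
      - pHalf n (i + 1) * p n (i + 2) * pHalf n (i + 2) * s n (i + 1) * L n (i + 1)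
        * pHalf n (i + 1) * s n (i + 2)

end

/-- The element `σ_i` of `𝒜_n(z)`, for `1 ≤ i ≤ n` (the value at `i = 0` is irrelevant). -/
noncomputable def sigma (n : ℕ) : ℕ → PartitionAlgebra n
  | 0 => 1
  | i + 1 => sigmaSucc n i

/-- The element `σ_{i + 1/2}` of `𝒜_n(z)`, for `i + 1 ≤ n`. -/
noncomputable def sigmaHalf (n : ℕ) : ℕ → PartitionAlgebra n
  | 0 => 1
  | 1 => 1
  | i + 2 =>
    s n (i + 1) * s n (i + 2) * sigmaHalf n (i + 1) * s n (i + 2) * s n (i + 1)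
      + pHalf n (i + 1) * L n (i + 1) * s n (i + 2) * pHalf n (i + 1) * s n (i + 2)
      + s n (i + 2) * pHalf n (i + 1) * L n (i + 1) * s n (i + 2) * pHalf n (i + 1)
      - pHalf n (i + 1) * L n (i + 1) * s n (i + 1) * pHalf n (i + 2) * p n (i + 2)
        * pHalf n (i + 1)
      - s n (i + 2) * pHalf n (i + 1) * p n (i + 2) * pHalf n (i + 2) * s n (i + 1) * L n (i + 1)
        * pHalf n (i + 1) * s n (i + 2)

/-- The element `L_{i + 1/2}` of `𝒜_n(z)`, for `i + 1 ≤ n`. -/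
noncomputable def LHalf (n : ℕ) : ℕ → PartitionAlgebra n
  | 0 => 0
  | i + 1 =>
    -(L n (i + 1) * pHalf n (i + 1)) - pHalf n (i + 1) * L n (i + 1)
      + pHalf n (i + 1) * L n (i + 1) * p n (i + 1) * pHalf n (i + 1)
      + s n (i + 1) * LHalf n i * s n (i + 1)
      + sigmaHalf n (i + 1)

/-- The recursion for `L_{i + 1}`, `i ≥ 1`, in its usual indexing. -/
theorem L_succ (n i : ℕ) (hi : 1 ≤ i) :
    L n (i + 1) = -(s n i * L n i * pHalf n i) - pHalf n i * L n i * s n i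
      + pHalf n i * L n i * p n (i + 1) * pHalf n i + s n i * L n i * s n i
      + sigma n (i + 1) := by
  obtain ⟨i, rfl⟩ := Nat.exists_eq_add_of_le' hi
  rw [L, sigma]

/-- The recursion for `σ_{i + 1}`, `i ≥ 2`, in its usual indexing. -/
theorem sigma_succ (n i : ℕ) (hi : 2 ≤ i) :
    sigma n (i + 1) = s n (i - 1) * s n i * sigma n i * s n i * s n (i - 1)
      + s n i * pHalf n (i - 1) * L n (i - 1) * s n i * pHalf n (i - 1) * s n i
      + pHalf n (i - 1) * L n (i - 1) * s n i * pHalf n (i - 1)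
      - s n i * pHalf n (i - 1) * L n (i - 1) * s n (i - 1) * pHalf n i * p n i * pHalf n (i - 1)
      - pHalf n (i - 1) * p n i * pHalf n i * s n (i - 1) * L n (i - 1) * pHalf n (i - 1)
        * s n i := by
  obtain ⟨i, rfl⟩ := Nat.exists_eq_add_of_le' hi
  rw [sigma, sigmaSucc, sigma]
  rfl

end JucysMurphy

end PartitionAlg

-- Specialise `z` to a natural number `N`. A diagram `d` then acts on integer functions of words `a
-- : Fin n → Ω`, with `|Ω| = N`, through a 0-1 matrix: the entry at `(a, b)` records whether
-- labelling the top row by `a` and the bottom row by `b` is constant on the blocks of `d`.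
-- Multiplying two such matrices counts labellings of the middle row, which produces the factor `N ^
-- ℓ`; hence `action` is a representation. A single `N` loses information (`z - N` acts as zero),
-- but all `N` together are faithful (`eq_zero_of_action_eq_zero`), so commutation may be checked on
-- operators.
--
-- On words the recursions have a closed solution. Count positions from 0, and let `(v c)_r`
-- exchange the letters `v` and `c` within the first `r` positions of a word. At a word `a`, L_{y+1}
-- gives the sum over `c` of f((a_y c)_{y+1} a), L_{y+1/2} gives the sum over `c` of f(a) - f((a_y
-- c)_y a), and, with x + 1 = y, σ_{y+1} gives f((a_x a_y)_{y+1} a) and σ_{y+1/2} gives f((a_x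
-- a_y)_x a). These formulas are proved by induction (`L_step`, `LHalf_step`, `sigma_step`,
-- `sigmaHalf_step`): the terms of each recursion are compared according to which of the letters at
-- two or three adjacent positions coincide.
--
-- The closed formulas are sums of products of two kinds of operators: `cut`, which reads a letter,
-- and `relabelOp`, which permutes the alphabet on an initial segment of positions. A diagram of A_m
-- commutes with relabelling the first r ≥ m positions, because this respects its blocks, and with
-- reading the letter at `j` if `j` and `j'` are joined. This gives the four centraliser statements.
-- The L's commute pairwise for the same reason: the operator with the smaller index commutes with
-- relabelling, since g (v c) g⁻¹ = (gv gc) and `c` runs over all of Ω, and it leaves alone the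
-- letter read by the other. Membership of L_i in 𝒜_i(z) is never needed.

namespace PartitionAlg

open PartitionAlgebra

-- Counting labellings of a stacked picture

section Counting

open scoped Classical in
/-- The number of labelings of the vertices that are constant on blocks and extend a labeling of
the image of `i`. -/
theorem card_labelings {V U Ω : Type} [Finite V] [Fintype Ω] (r : Setoid V)
    (i : U → V) (h : U → Ω) :
    Nat.card {F : V → Ω // r ≤ Setoid.ker F ∧ ∀ u, F (i u) = h u} =
      if r.comap i ≤ Setoid.ker h then Fintype.card Ω ^ missed r i else 0 := by
  split_ifs with hc
  -- A block that meets the image of `i` has its label forced by `h`, consistently by `hc`; the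
  -- blocks in `S` are labelled freely.
  · let S : Set (Quotient r) := (Set.range fun u => Quotient.mk r (i u))ᶜ
    have hS : ∀ v, (¬ ∃ u, r (i u) v) → Quotient.mk r v ∈ S := by
      rintro v hv ⟨u, hu⟩
      exact hv ⟨u, Quotient.exact hu⟩
    let e : {F : V → Ω // r ≤ Setoid.ker F ∧ ∀ u, F (i u) = h u} ≃ (S → Ω) :=
      { toFun := fun F c => Quotient.lift F.1 (fun _ _ hab => F.2.1 hab) c.1
        invFun := fun G => ⟨fun v => if hv : ∃ u, r (i u) v then h hv.choose
            else G ⟨Quotient.mk r v, hS v hv⟩, by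
          constructor
          · intro a b hab
            rw [Setoid.ker_def]
            by_cases ha : ∃ u, r (i u) a
            · have hb : ∃ u, r (i u) b := ha.imp fun u hu => r.trans hu hab
              rw [dif_pos ha, dif_pos hb]
              exact hc (r.trans ha.choose_spec (r.trans hab (r.symm hb.choose_spec)))
            · have hb : ¬ ∃ u, r (i u) b := fun ⟨u, hu⟩ => ha ⟨u, r.trans hu (r.symm hab)⟩
              rw [dif_neg ha, dif_neg hb]
              congr 2
              exact Quotient.sound hab
          · intro u
            have hu : ∃ u', r (i u') (i u) := ⟨u, r.refl _⟩
            exact (dif_pos hu).trans (hc hu.choose_spec)⟩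
        left_inv := by
          rintro ⟨F, hF, hF'⟩
          ext v
          by_cases hv : ∃ u, r (i u) v
          · simp only [dif_pos hv]
            rw [← hF']
            exact hF hv.choose_spec
          · simp only [dif_neg hv]
            rfl
        right_inv := by
          intro G
          ext ⟨c, hcS⟩
          induction c using Quotient.inductionOn with
          | _ v =>
          have hv : ¬ ∃ u, r (i u) v := fun ⟨u, hu⟩ => hcS ⟨u, Quotient.sound hu⟩
          change dite _ _ _ = _
          rw [dif_neg hv] }
    rw [Nat.card_congr e, Nat.card_fun, Nat.card_eq_fintype_card, Nat.card_coe_set_eq]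
    rfl
  · rw [Nat.card_eq_zero]
    left
    refine ⟨fun ⟨F, hF, hF'⟩ => hc fun a b hab => ?_⟩
    rw [Setoid.ker_def, ← hF', ← hF']
    exact hF hab

-- A labelling of the middle row is a labelling of the whole stacked picture with prescribed outer
-- rows. The components that reach an outer row are forced, and each closed middle component
-- contributes a free choice.
open scoped Classical in
theorem card_middle_labelings {X Y Z Ω : Type} [Finite X] [Finite Y] [Finite Z] [Fintype Ω]
    (d : Setoid (X ⊕ Y)) (e : Setoid (Y ⊕ Z)) (a : X → Ω) (b : Z → Ω) :
    Nat.card {m : Y → Ω // d ≤ Setoid.ker (Sum.elim a m) ∧ e ≤ Setoid.ker (Sum.elim m b)} =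
      if comp d e ≤ Setoid.ker (Sum.elim a b) then Fintype.card Ω ^ loops d e else 0 := by
  rw [comp, loops, ← card_labelings]
  have key : ∀ F : X ⊕ (Y ⊕ Z) → Ω, stack d e ≤ Setoid.ker F ↔
      d ≤ Setoid.ker (fun v => F (Sum.map id Sum.inl v)) ∧
        e ≤ Setoid.ker (fun v => F (Sum.inr v)) := by
    intro F
    rw [stack, sup_le_iff, map_le_iff, map_le_iff]
    rfl
  have h1 : ∀ (m : Y → Ω), (fun v : X ⊕ Y => (Sum.elim a (Sum.elim m b) : X ⊕ (Y ⊕ Z) → Ω)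
      (Sum.map id Sum.inl v)) = Sum.elim a m := by
    intro m
    funext v
    rcases v with v | v <;> rfl
  have h3 : ∀ F : X ⊕ (Y ⊕ Z) → Ω, (∀ u, F (outer u) = Sum.elim a b u) →
      F = Sum.elim a (Sum.elim (fun y => F (Sum.inr (Sum.inl y))) b) := by
    intro F hF
    funext v
    rcases v with v | v | v
    · exact hF (Sum.inl v)
    · rfl
    · exact hF (Sum.inr v)
  refine Nat.card_congr
    { toFun := fun m => ⟨Sum.elim a (Sum.elim m.1 b), ?_, ?_⟩
      invFun := fun F => ⟨fun y => F.1 (Sum.inr (Sum.inl y)), ?_⟩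
      left_inv := fun m => rfl
      right_inv := fun F => Subtype.ext (h3 F.1 F.2.2).symm }
  · rw [key, h1]
    exact m.2
  · rintro (u | u) <;> rfl
  · have h := (key F.1).1 F.2.1
    rw [h3 F.1 F.2.2, h1] at h
    exact h

end Counting

-- The representation on functions of words, and its joint faithfulness

section Representation

variable {n : ℕ} {Ω : Type} [Fintype Ω]

open scoped Classical in
/-- The action of a diagram on functions of labelings of a row. -/
noncomputable def diagramAction (Ω : Type) [Fintype Ω] (d : Diagram n) :
    Module.End ℤ ((Fin n → Ω) → ℤ) where
  toFun f a := ∑ b, if d ≤ Setoid.ker (Sum.elim a b) then f b else 0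
  map_add' f g := by
    ext a
    simp only [Pi.add_apply, ← Finset.sum_add_distrib]
    exact Finset.sum_congr rfl fun b _ => by split_ifs <;> simp
  map_smul' c f := by
    ext a
    simp [Finset.mul_sum]

open scoped Classical in
theorem diagramAction_apply (d : Diagram n) (f : (Fin n → Ω) → ℤ) (a : Fin n → Ω) :
    diagramAction Ω d f a = ∑ b, if d ≤ Setoid.ker (Sum.elim a b) then f b else 0 := rfl

/-- Each entry of the matrix product is a number of labellings of the middle row, so
`card_middle_labelings` evaluates it. -/
theorem diagramAction_mul (d e : Diagram n) :
    diagramAction Ω d * diagramAction Ω e =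
      ((Fintype.card Ω : ℤ) ^ loops d e) • diagramAction Ω (comp d e) := by
  classical
  refine LinearMap.ext fun f => funext fun a => ?_
  simp only [Module.End.mul_apply, LinearMap.smul_apply, Pi.smul_apply, diagramAction_apply,
    smul_eq_mul, Finset.mul_sum]
  have h : ∀ m : Fin n → Ω, (if d ≤ Setoid.ker (Sum.elim a m) then
      ∑ b, (if e ≤ Setoid.ker (Sum.elim m b) then f b else 0) else 0) =
      ∑ b, if d ≤ Setoid.ker (Sum.elim a m) ∧ e ≤ Setoid.ker (Sum.elim m b) then f b else 0 := by
    intro m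
    split_ifs with h <;> simp [h]
  simp only [h]
  rw [Finset.sum_comm]
  refine Finset.sum_congr rfl fun b _ => ?_
  rw [← Finset.sum_filter, Finset.sum_const, ← Fintype.card_subtype, ← Nat.card_eq_fintype_card,
    card_middle_labelings]
  split_ifs <;> simp

theorem diagramAction_idDiagram : diagramAction Ω (idDiagram (Fin n)) = 1 := by
  classical
  refine LinearMap.ext fun f => funext fun a => ?_
  have h : ∀ b : Fin n → Ω, idDiagram (Fin n) ≤ Setoid.ker (Sum.elim a b) ↔ a = b := by
    intro b
    constructor
    · intro h
      funext j
      exact @h (Sum.inl j) (Sum.inr j) rfl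
    · rintro rfl (u | u) (v | v) huv <;> obtain rfl : u = v := huv <;> rfl
  simp [diagramAction_apply, h]

/-- The action of the partition algebra, with parameter specialised to the number of labels, on
functions of labelings. -/
noncomputable def action (n : ℕ) (Ω : Type) [Fintype Ω] :
    PartitionAlgebra n →+* Module.End ℤ ((Fin n → Ω) → ℤ) :=
  let φ : PartitionAlgebra n →+ Module.End ℤ ((Fin n → Ω) → ℤ) :=
    Finsupp.liftAddHom fun d : Diagram n =>
      ((smulAddHom ℤ (Module.End ℤ ((Fin n → Ω) → ℤ))).flip (diagramAction Ω d)).comp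
        (evalRingHom (Fintype.card Ω : ℤ)).toAddMonoidHom
  have hs : ∀ d c, φ (single d c) = c.eval (Fintype.card Ω : ℤ) • diagramAction Ω d := fun d c =>
    Finsupp.liftAddHom_apply_single _ d c
  { φ with
    map_one' := by
      change φ (single _ 1) = 1
      rw [hs, eval_one, one_smul, diagramAction_idDiagram]
    map_mul' := by
      intro x y
      change φ (x * y) = φ x * φ y
      induction x using induction_on with
      | h0 => simp
      | hadd x x' h h' => rw [add_mul, map_add, map_add, h, h', add_mul]
      | hs d r =>
      induction y using induction_on with
      | h0 => simp
      | hadd y y' h h' => rw [mul_add, map_add, map_add, h, h', mul_add]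
      | hs e t =>
      rw [single_mul_single, hs, hs, hs, smul_mul_smul_comm, diagramAction_mul, smul_smul]
      simp }

theorem action_single (d : Diagram n) (c : ℤ[X]) :
    action n Ω (single d c) = c.eval (Fintype.card Ω : ℤ) • diagramAction Ω d :=
  Finsupp.liftAddHom_apply_single _ d c

theorem action_ofDiagram (d : Diagram n) : action n Ω (ofDiagram d) = diagramAction Ω d := by
  rw [ofDiagram, action_single, eval_one, one_smul]

theorem action_eq_sum (x : Diagram n →₀ ℤ[X]) :
    action n Ω (x : PartitionAlgebra n) =
      ∑ d ∈ x.support, (x d).eval (Fintype.card Ω : ℤ) • diagramAction Ω d :=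
  rfl

/-- Let `d` be a finest diagram in the support. If the blocks of `d` receive distinct letters, the
resulting pair of words is compatible with `e` only if `e ≤ d`, so by minimality this matrix entry
of `x` is the coefficient of `d` evaluated at `N`. It vanishes for all large `N`, and a polynomial
with infinitely many roots is zero. -/
theorem eq_zero_of_action_eq_zero (x : PartitionAlgebra n)
    (h : ∀ N : ℕ, action n (Fin N) x = 0) : x = 0 := by
  classical
  by_contra hx
  let x' : Diagram n →₀ ℤ[X] := x
  have hne : x'.support.Nonempty := Finsupp.support_nonempty_iff.2 hx
  obtain ⟨d, hd, hmin⟩ := x'.support.exists_minimal hne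
  refine Finsupp.mem_support_iff.1 hd ?_
  -- The shift by the number of blocks guarantees enough letters for an injective labelling.
  have hev : ∀ N : ℕ, (x' d).eval ((Nat.card (Quotient d) + N : ℕ) : ℤ) = 0 := by
    intro N
    have : Fintype (Quotient d) := Fintype.ofFinite _
    obtain ⟨F⟩ : Nonempty (Quotient d ↪ Fin (Nat.card (Quotient d) + N)) := by
      apply Function.Embedding.nonempty_of_card_le
      simp
    let a : Fin n → Fin (Nat.card (Quotient d) + N) := fun j => F (Quotient.mk d (Sum.inl j))
    let b : Fin n → Fin (Nat.card (Quotient d) + N) := fun j => F (Quotient.mk d (Sum.inr j))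
    have hker : Setoid.ker (Sum.elim a b) = d := by
      have hab : Sum.elim a b = fun v => F (Quotient.mk d v) := by
        funext v
        rcases v with v | v <;> rfl
      rw [hab]
      ext u v
      rw [Setoid.ker_def]
      exact F.injective.eq_iff.trans Quotient.eq
    have h0 := congrFun (LinearMap.congr_fun (h (Nat.card (Quotient d) + N)) (Pi.single b 1)) a
    have hT : ∀ e : Diagram n, diagramAction (Fin (Nat.card (Quotient d) + N)) e
        (Pi.single b 1) a = if e ≤ d then 1 else 0 := by
      intro e
      rw [diagramAction_apply, Finset.sum_eq_single b]
      · rw [hker, Pi.single_eq_same]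
      · intro c _ hc
        simp [Pi.single_eq_of_ne hc]
      · simp
    rw [action_eq_sum x', LinearMap.sum_apply, Finset.sum_apply,
      Finset.sum_eq_single d] at h0
    · simpa [hT] using h0
    · intro e he hed
      have : ¬ e ≤ d := fun hle => hed (le_antisymm hle (hmin he hle))
      simp [hT, this]
    · exact fun hd' => absurd hd hd'
  refine Polynomial.eq_zero_of_infinite_isRoot _ ?_
  refine Set.infinite_of_injective_forall_mem
    (f := fun N : ℕ => ((Nat.card (Quotient d) + N : ℕ) : ℤ)) ?_ hev
  intro M N hMN
  simpa using hMN

theorem commute_of_action {x y : PartitionAlgebra n}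
    (h : ∀ N : ℕ, Commute (action n (Fin N) x) (action n (Fin N) y)) : Commute x y := by
  refine sub_eq_zero.1 (eq_zero_of_action_eq_zero _ fun N => ?_)
  rw [map_sub, map_mul, map_mul, (h N).eq, sub_self]

end Representation

-- Action of the generators on words

section Generators

variable {n : ℕ} {Ω : Type} [Fintype Ω] [DecidableEq Ω]

theorem label_injective : Function.Injective (label : Fin n → ℕ) := fun _ _ h =>
  Fin.ext (Nat.succ_injective h)

theorem label_eq_iff {i : ℕ} {x a : Fin n} (hx : x.val = i) : label a = i + 1 ↔ a = x := by
  subst hx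
  exact label_injective.eq_iff (b := x)

theorem action_s_apply {i : ℕ} {x y : Fin n} (hx : x.val = i) (hy : y.val = i + 1)
    (f : (Fin n → Ω) → ℤ) (a : Fin n → Ω) :
    action n Ω (s n (i + 1)) f a = f (fun j => a (Equiv.swap x y j)) := by
  classical
  have hl : ∀ j : Fin n, Equiv.swap (i + 1) (i + 1 + 1) (label j) = label (Equiv.swap x y j) := by
    intro j
    rw [← label_injective.swap_apply]
    simp only [label, hx, hy]
  have h : ∀ b : Fin n → Ω,
      Setoid.ker (Sum.elim (fun j : Fin n => Equiv.swap (i + 1) (i + 1 + 1) (label j)) label) ≤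
        Setoid.ker (Sum.elim a b) ↔ b = fun j => a (Equiv.swap x y j) := by
    intro b
    constructor
    · intro h
      funext j
      refine (@h (Sum.inl (Equiv.swap x y j)) (Sum.inr j) ?_).symm
      rw [Setoid.ker_def]
      simp [hl]
    · rintro rfl (u | u) (v | v) huv <;> rw [Setoid.ker_def] at huv ⊢ <;>
        simp only [Sum.elim_inl, Sum.elim_inr, hl, label_injective.eq_iff] at huv ⊢
      · rw [(Equiv.swap x y).injective huv]
      · rw [← huv, Equiv.swap_apply_self]
      · rw [huv, Equiv.swap_apply_self]
      · rw [huv]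
  rw [s, action_ofDiagram, diagramAction_apply]
  simp only [h, Finset.sum_ite_eq', Finset.mem_univ, if_true]

theorem action_p_apply {i : ℕ} {x : Fin n} (hx : x.val = i)
    (f : (Fin n → Ω) → ℤ) (a : Fin n → Ω) :
    action n Ω (p n (i + 1)) f a = ∑ c, f (Function.update a x c) := by
  classical
  have h : ∀ b : Fin n → Ω,
      Setoid.ker (Sum.elim label fun j : Fin n => if label j = i + 1 then 0 else label j) ≤
        Setoid.ker (Sum.elim a b) ↔ ∃ c, Function.update a x c = b := by
    intro b
    simp only [label_eq_iff hx]
    constructor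
    · intro h
      refine ⟨b x, funext fun j => ?_⟩
      by_cases hj : j = x
      · rw [hj, Function.update_self]
      · rw [Function.update_of_ne hj]
        refine @h (Sum.inl j) (Sum.inr j) ?_
        simp [Setoid.ker_def, hj]
    -- Labels start at 1, so the value 0 given to the bottom vertex at `x` isolates it.
    · have h0 : ∀ u : Fin n, label u ≠ 0 := fun u => Nat.succ_ne_zero _
      have h0' : ∀ u : Fin n, 0 ≠ label u := fun u => (h0 u).symm
      rintro ⟨c, rfl⟩ (u | u) (v | v) huv <;> rw [Setoid.ker_def] at huv ⊢ <;>
        simp only [Sum.elim_inl, Sum.elim_inr] at huv ⊢ <;>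
        (try split_ifs at huv) <;> simp_all [label_injective.eq_iff]
  rw [p, action_ofDiagram, diagramAction_apply]
  simp only [h]
  rw [← Finset.sum_filter]
  have hinj : Function.Injective fun c => Function.update a x c := Function.update_injective a x
  rw [← Finset.sum_image (g := fun c => Function.update a x c) (s := Finset.univ) (f := f)
    (fun _ _ _ _ h => hinj h)]
  congr 1
  ext b
  simp

theorem action_pHalf_apply {i : ℕ} {x y : Fin n} (hx : x.val = i) (hy : y.val = i + 1)
    (f : (Fin n → Ω) → ℤ) (a : Fin n → Ω) :
    action n Ω (pHalf n (i + 1)) f a = if a x = a y then f a else 0 := by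
  classical
  have hxy : x ≠ y := by
    rintro rfl
    omega
  have hl : ∀ j : Fin n, (if label j = i + 1 + 1 then i + 1 else label j) =
      label (if j = y then x else j) := by
    intro j
    simp only [label_eq_iff hy]
    split_ifs with hj
    · rw [label, hx]
    · rfl
  have h : ∀ b : Fin n → Ω,
      Setoid.ker (Sum.elim (fun j : Fin n => if label j = i + 1 + 1 then i + 1 else label j)
        (fun j : Fin n => if label j = i + 1 + 1 then i + 1 else label j)) ≤
        Setoid.ker (Sum.elim a b) ↔ b = a ∧ a x = a y := by
    intro b
    simp only [hl]
    constructor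
    · intro h
      refine ⟨funext fun j => (@h (Sum.inl j) (Sum.inr j) rfl).symm,
        @h (Sum.inl x) (Sum.inl y) ?_⟩
      simp [Setoid.ker_def, hxy]
    · rintro ⟨rfl, hb⟩
      have hb' : ∀ j, b (if j = y then x else j) = b j := by
        intro j
        split_ifs with hj
        · rw [hb, hj]
        · rfl
      rintro (u | u) (v | v) huv <;> rw [Setoid.ker_def] at huv ⊢ <;>
        simp only [Sum.elim_inl, Sum.elim_inr, label_injective.eq_iff] at huv ⊢ <;>
        rw [← hb', huv, hb']
  rw [pHalf, action_ofDiagram, diagramAction_apply]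
  simp only [h, ite_and, Finset.sum_ite_eq', Finset.mem_univ, if_true]

end Generators

-- Closed formulas for the operators of L and σ

section Operators

variable {n : ℕ} {Ω : Type}

/-- Relabel the first `r` positions by the permutation `g`. -/
def relabel (r : ℕ) (g : Equiv.Perm Ω) (a : Fin n → Ω) : Fin n → Ω :=
  fun j => if j.val < r then g (a j) else a j

theorem relabel_refl (r : ℕ) (a : Fin n → Ω) : relabel r (Equiv.refl Ω) a = a := by
  funext j
  simp [relabel]

theorem relabel_zero (g : Equiv.Perm Ω) (a : Fin n → Ω) : relabel 0 g a = a := by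
  funext j
  simp [relabel]

theorem relabel_relabel_swap [DecidableEq Ω] {q r : ℕ} (hqr : q ≤ r) (g : Equiv.Perm Ω) (v c : Ω)
    (a : Fin n → Ω) :
    relabel q (Equiv.swap (g v) (g c)) (relabel r g a) =
      relabel r g (relabel q (Equiv.swap v c) a) := by
  funext j
  simp only [relabel]
  by_cases hq : j.val < q
  · rw [if_pos hq, if_pos hq, if_pos (hq.trans_le hqr), if_pos (hq.trans_le hqr)]
    exact g.injective.swap_apply _ _ _
  · rw [if_neg hq, if_neg hq]

theorem relabel_relabel_symm (r : ℕ) (g : Equiv.Perm Ω) (a : Fin n → Ω) :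
    relabel r g.symm (relabel r g a) = a := by
  funext j
  by_cases h : j.val < r <;> simp [relabel, h]

/-- The operator that restricts the support of a function to labelings with label `v` at `j`. -/
def cut [DecidableEq Ω] (j : Fin n) (v : Ω) : Module.End ℤ ((Fin n → Ω) → ℤ) where
  toFun f a := if a j = v then f a else 0
  map_add' f g := by
    ext a
    by_cases h : a j = v <;> simp [h]
  map_smul' c f := by
    ext a
    simp

/-- The operator of pulling back along a relabeling of the first `r` positions. -/
def relabelOp (r : ℕ) (g : Equiv.Perm Ω) : Module.End ℤ ((Fin n → Ω) → ℤ) where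
  toFun f a := f (relabel r g a)
  map_add' _ _ := rfl
  map_smul' _ _ := rfl

variable [Fintype Ω] [DecidableEq Ω]

/-- The operator by which `L_{y + 1}` acts; the position `y` is counted from `0`. -/
def opL (Ω : Type) [Fintype Ω] [DecidableEq Ω] (y : Fin n) : Module.End ℤ ((Fin n → Ω) → ℤ) :=
  ∑ v, ∑ c, cut y v * relabelOp (y.val + 1) (Equiv.swap v c)

/-- The operator by which `L_{y + 1/2}` acts. -/
def opLHalf (Ω : Type) [Fintype Ω] [DecidableEq Ω] (y : Fin n) :
    Module.End ℤ ((Fin n → Ω) → ℤ) :=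
  ∑ v, ∑ c, cut y v * (1 - relabelOp y.val (Equiv.swap v c))

/-- The operator by which `σ_{y + 1}` acts, where `x + 1 = y`. -/
def opSigma (Ω : Type) [Fintype Ω] [DecidableEq Ω] (x y : Fin n) :
    Module.End ℤ ((Fin n → Ω) → ℤ) :=
  ∑ v, ∑ w, cut x v * cut y w * relabelOp (y.val + 1) (Equiv.swap v w)

/-- The operator by which `σ_{y + 1/2}` acts, where `x + 1 = y`. -/
def opSigmaHalf (Ω : Type) [Fintype Ω] [DecidableEq Ω] (x y : Fin n) :
    Module.End ℤ ((Fin n → Ω) → ℤ) :=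
  ∑ v, ∑ w, cut x v * cut y w * relabelOp x.val (Equiv.swap v w)

theorem opL_apply (y : Fin n) (f : (Fin n → Ω) → ℤ) (a : Fin n → Ω) :
    opL Ω y f a = ∑ c, f (relabel (y.val + 1) (Equiv.swap (a y) c) a) := by
  -- With the sum over `v` innermost, `cut` leaves only the term `v = a y`. The letter is read
  -- before the relabelling, because `cut` stands on the left.
  rw [opL, Finset.sum_comm]
  simp [cut, relabelOp]

theorem opLHalf_apply (y : Fin n) (f : (Fin n → Ω) → ℤ) (a : Fin n → Ω) :
    opLHalf Ω y f a = ∑ c, (f a - f (relabel y.val (Equiv.swap (a y) c) a)) := by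
  rw [opLHalf, Finset.sum_comm]
  simp [cut, relabelOp]

theorem opSigma_apply (x y : Fin n) (f : (Fin n → Ω) → ℤ) (a : Fin n → Ω) :
    opSigma Ω x y f a = f (relabel (y.val + 1) (Equiv.swap (a x) (a y)) a) := by
  simp [opSigma, cut, relabelOp]

theorem opSigmaHalf_apply (x y : Fin n) (f : (Fin n → Ω) → ℤ) (a : Fin n → Ω) :
    opSigmaHalf Ω x y f a = f (relabel x.val (Equiv.swap (a x) (a y)) a) := by
  simp [opSigmaHalf, cut, relabelOp]

end Operators

-- Commutation of the closed formulas

section Commutation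

variable {n : ℕ} {Ω : Type} [Fintype Ω] [DecidableEq Ω]
  {M : Module.End ℤ ((Fin n → Ω) → ℤ)} {x y : Fin n}

/-- This and the three analogues below reduce commutation to the building blocks; `M` will be either
a diagram or another such operator. -/
theorem commute_opL (hc : ∀ v, Commute (cut y v) M)
    (hr : ∀ g, Commute (relabelOp (y.val + 1) g) M) : Commute (opL Ω y) M :=
  Commute.sum_left _ _ _ fun v _ => Commute.sum_left _ _ _ fun _ _ => (hc v).mul_left (hr _)

theorem commute_opLHalf (hc : ∀ v, Commute (cut y v) M)
    (hr : ∀ g, Commute (relabelOp y.val g) M) : Commute (opLHalf Ω y) M :=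
  Commute.sum_left _ _ _ fun v _ => Commute.sum_left _ _ _ fun _ _ =>
    (hc v).mul_left ((Commute.one_left _).sub_left (hr _))

theorem commute_opSigma (hx : ∀ v, Commute (cut x v) M) (hy : ∀ v, Commute (cut y v) M)
    (hr : ∀ g, Commute (relabelOp (y.val + 1) g) M) : Commute (opSigma Ω x y) M :=
  Commute.sum_left _ _ _ fun v _ => Commute.sum_left _ _ _ fun w _ =>
    ((hx v).mul_left (hy w)).mul_left (hr _)

theorem commute_opSigmaHalf (hx : ∀ v, Commute (cut x v) M) (hy : ∀ v, Commute (cut y v) M)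
    (hr : ∀ g, Commute (relabelOp x.val g) M) : Commute (opSigmaHalf Ω x y) M :=
  Commute.sum_left _ _ _ fun v _ => Commute.sum_left _ _ _ fun w _ =>
    ((hx v).mul_left (hy w)).mul_left (hr _)

/-- `opL Ω x` rewrites only positions up to `x`, so the letter at `y` survives. For `opLHalf` the
position `x` itself is also untouched, which allows `x = y` in the next lemma. -/
theorem cut_commute_opL (h : x < y) (v : Ω) : Commute (cut y v) (opL Ω x) := by
  refine LinearMap.ext fun f => funext fun a => ?_
  have hy : ∀ g : Equiv.Perm Ω, relabel (x.val + 1) g a y = a y := fun g => by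
    rw [relabel, if_neg (by have := Fin.lt_def.1 h; omega)]
  simp only [Module.End.mul_apply, opL_apply, cut, LinearMap.coe_mk, AddHom.coe_mk, hy]
  split_ifs <;> simp

theorem cut_commute_opLHalf (h : x ≤ y) (v : Ω) : Commute (cut y v) (opLHalf Ω x) := by
  refine LinearMap.ext fun f => funext fun a => ?_
  have hy : ∀ g : Equiv.Perm Ω, relabel x.val g a y = a y := fun g => by
    rw [relabel, if_neg (by have := Fin.le_def.1 h; omega)]
  simp only [Module.End.mul_apply, opLHalf_apply, cut, LinearMap.coe_mk, AddHom.coe_mk, hy]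
  split_ifs <;> simp

/-- Conjugation by `g` turns the transposition of `v` and `c` into that of `g v` and `g c`; the sum
over all `c` absorbs this by the substitution of `g c` for `c`. -/
theorem relabelOp_commute_opL {r : ℕ} (h : x.val < r) (g : Equiv.Perm Ω) :
    Commute (relabelOp r g) (opL Ω x) := by
  refine LinearMap.ext fun f => funext fun a => ?_
  have hx : relabel r g a x = g (a x) := if_pos h
  simp only [Module.End.mul_apply, opL_apply, relabelOp, LinearMap.coe_mk, AddHom.coe_mk, hx]
  rw [← Equiv.sum_comp g]
  simp only [relabel_relabel_swap (Nat.succ_le_of_lt h)]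

theorem relabelOp_commute_opLHalf {r : ℕ} (h : x.val < r) (g : Equiv.Perm Ω) :
    Commute (relabelOp r g) (opLHalf Ω x) := by
  refine LinearMap.ext fun f => funext fun a => ?_
  have hx : relabel r g a x = g (a x) := if_pos h
  simp only [Module.End.mul_apply, opLHalf_apply, relabelOp, LinearMap.coe_mk, AddHom.coe_mk, hx]
  rw [← Equiv.sum_comp g]
  simp only [relabel_relabel_swap h.le]

theorem commute_opL_opL (h : x < y) : Commute (opL Ω y) (opL Ω x) :=
  commute_opL (cut_commute_opL h) (relabelOp_commute_opL (Nat.lt_succ_of_lt h))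

theorem commute_opL_opLHalf (h : x ≤ y) : Commute (opL Ω y) (opLHalf Ω x) :=
  commute_opL (cut_commute_opLHalf h) (relabelOp_commute_opLHalf (Nat.lt_succ_of_le h))

theorem commute_opLHalf_opL (h : x < y) : Commute (opLHalf Ω y) (opL Ω x) :=
  commute_opLHalf (cut_commute_opL h) (relabelOp_commute_opL h)

theorem commute_opLHalf_opLHalf (h : x < y) : Commute (opLHalf Ω y) (opLHalf Ω x) :=
  commute_opLHalf (cut_commute_opLHalf h.le) (relabelOp_commute_opLHalf h)

end Commutation

-- Diagrams commute with relabelling and with reading a letter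

section Diagrams

variable {n m : ℕ} {Ω : Type}

theorem Diagram.extend_rel (d : Diagram m) {u v : Fin n ⊕ Fin n} (h : d.extend n u v) :
    ((Sum.elim id id u : Fin n).val < m ∧ (Sum.elim id id v : Fin n).val < m) ∨
      (Sum.elim id id u : Fin n) = Sum.elim id id v := by
  rw [Setoid.ker_def] at h
  rcases u with u | u <;> rcases v with v | v <;>
    simp only [Sum.elim_inl, Sum.elim_inr, id] at h ⊢ <;> split_ifs at h with h1 h2 <;>
    simp_all [Fin.ext_iff]

theorem Diagram.extend_rel_of_le (d : Diagram m) {j : Fin n} (hj : m ≤ j.val) :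
    d.extend n (Sum.inl j) (Sum.inr j) := by
  rw [Setoid.ker_def]
  simp [Nat.not_lt.2 hj]

/-- Each block lies within the first `m` positions, where `g` acts on all its vertices, or is some
`{j, j'}`, whose two vertices are treated alike. -/
theorem extend_le_ker_relabel {r : ℕ} (hr : m ≤ r) (d : Diagram m) (g : Equiv.Perm Ω)
    {a b : Fin n → Ω} (h : d.extend n ≤ Setoid.ker (Sum.elim a b)) :
    d.extend n ≤ Setoid.ker (Sum.elim (relabel r g a) (relabel r g b)) := by
  have hel : ∀ u : Fin n ⊕ Fin n, (Sum.elim (relabel r g a) (relabel r g b) u : Ω) =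
      if (Sum.elim id id u : Fin n).val < r then g (Sum.elim a b u) else Sum.elim a b u := by
    rintro (u | u) <;> rfl
  intro u v huv
  have h1 : Sum.elim a b u = Sum.elim a b v := h huv
  rw [Setoid.ker_def, hel, hel, h1]
  rcases d.extend_rel huv with ⟨hu, hv⟩ | huv
  · rw [if_pos (hu.trans_le hr), if_pos (hv.trans_le hr)]
  · rw [huv]

variable [Fintype Ω]

theorem cut_commute_diagramAction [DecidableEq Ω] {d : Diagram n} {j : Fin n}
    (h : d (Sum.inl j) (Sum.inr j)) (v : Ω) : Commute (cut j v) (diagramAction Ω d) := by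
  classical
  refine LinearMap.ext fun f => funext fun a => ?_
  simp only [Module.End.mul_apply, diagramAction_apply, cut, LinearMap.coe_mk, AddHom.coe_mk]
  have key : ∀ b : Fin n → Ω, d ≤ Setoid.ker (Sum.elim a b) → a j = b j := fun b hb => hb h
  split_ifs with hv
  · refine Finset.sum_congr rfl fun b _ => ?_
    split_ifs with hd hb
    · rfl
    · exact absurd ((key b hd).symm.trans hv) hb
    · rfl
  · refine (Finset.sum_eq_zero fun b _ => ?_).symm
    split_ifs with hd hb
    · exact absurd ((key b hd).trans hb) hv
    · rfl
    · rfl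

/-- The matrix entry at `(a, b)` is unchanged when both words are relabelled, so relabelling the
summation word `b` moves the operator across. -/
theorem relabelOp_commute_diagramAction {r : ℕ} (hr : m ≤ r) (d : Diagram m)
    (g : Equiv.Perm Ω) : Commute (relabelOp r g) (diagramAction Ω (d.extend n)) := by
  classical
  refine LinearMap.ext fun f => funext fun a => ?_
  simp only [Module.End.mul_apply, diagramAction_apply, relabelOp, LinearMap.coe_mk,
    AddHom.coe_mk]
  let e : (Fin n → Ω) ≃ (Fin n → Ω) :=
    { toFun := relabel r g
      invFun := relabel r g.symm
      left_inv := relabel_relabel_symm r g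
      right_inv := relabel_relabel_symm r g.symm }
  rw [← Equiv.sum_comp e]
  refine Finset.sum_congr rfl fun b _ =>
    if_congr ⟨fun h => ?_, extend_le_ker_relabel hr d g⟩ rfl rfl
  have := extend_le_ker_relabel hr d g.symm h
  rwa [relabel_relabel_symm, show e b = relabel r g b from rfl, relabel_relabel_symm] at this

theorem commute_of_mem_adjoin {S : Set (PartitionAlgebra n)} {x : PartitionAlgebra n}
    (h : ∀ a ∈ S, Commute x a) : ∀ a ∈ Algebra.adjoin ℤ[X] S, Commute x a := by
  intro a ha
  induction ha using Algebra.adjoin_induction with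
  | mem a ha => exact h a ha
  | algebraMap r => exact (Algebra.commutes r x).symm
  | add a b _ _ ha hb => exact ha.add_right hb
  | mul a b _ _ ha hb => exact ha.mul_right hb

end Diagrams

-- Comparing words position by position

section Agreement

variable {n : ℕ} {Ω : Type}

theorem eq_of_agree_two {x y : Fin n} {b c : Fin n → Ω} (hx : b x = c x) (hy : b y = c y)
    (h : ∀ j, j ≠ x → j ≠ y → b j = c j) : b = c := by
  funext j
  by_cases hjx : j = x
  · rwa [hjx]
  by_cases hjy : j = y
  · rwa [hjy]
  exact h j hjx hjy

theorem eq_of_agree_three {x y z : Fin n} {b c : Fin n → Ω} (hx : b x = c x) (hy : b y = c y)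
    (hz : b z = c z) (h : ∀ j, j ≠ x → j ≠ y → j ≠ z → b j = c j) : b = c := by
  refine eq_of_agree_two hx hy fun j hjx hjy => ?_
  by_cases hjz : j = z
  · rwa [hjz]
  exact h j hjx hjy hjz

end Agreement

-- The recursions are solved by the closed formulas

section Recursion

variable {n : ℕ} {Ω : Type} [Fintype Ω] [DecidableEq Ω]

theorem L_step {i : ℕ} {x y : Fin n} (hx : x.val = i) (hy : y.val = i + 1)
    (hL : action n Ω (L n (i + 1)) = opL Ω x)
    (hs : action n Ω (sigmaSucc n (i + 1)) = opSigma Ω x y) :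
    action n Ω (L n (i + 2)) = opL Ω y := by
  have hp : ∀ (f : (Fin n → Ω) → ℤ) a, action n Ω (p n (i + 2)) f a =
    ∑ c, f (Function.update a y c) := action_p_apply hy
  refine LinearMap.ext fun f => funext fun a => ?_
  have hxy : x ≠ y := fun h => by rw [h] at hx; omega
  have hyx := hxy.symm
  rw [L]
  simp only [map_add, map_sub, map_neg, map_mul, hL, hs, LinearMap.add_apply,
    LinearMap.sub_apply, LinearMap.neg_apply, Module.End.mul_apply, Pi.add_apply, Pi.sub_apply,
    Pi.neg_apply, action_s_apply hx hy, action_pHalf_apply hx hy, opL_apply, opSigma_apply, hp]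
  have rx : ∀ g (b : Fin n → Ω), relabel (x.val + 1) g b x = g (b x) := fun g b => if_pos (by omega)
  have ry : ∀ g (b : Fin n → Ω), relabel (x.val + 1) g b y = b y := fun g b => if_neg (by omega)
  simp only [rx, ry, Equiv.swap_apply_left, Equiv.swap_apply_right, Function.update_self,
    Function.update_of_ne hxy, Finset.sum_ite_eq, Finset.sum_ite_eq', Finset.mem_univ, if_true]
  have lx : ∀ j : Fin n, j ≠ x → (j.val < x.val + 1 ↔ j.val < x.val) := fun j hj => by
    have := Fin.val_ne_of_ne hj; omega
  have ly : ∀ j : Fin n, j ≠ x → j ≠ y → (j.val < y.val + 1 ↔ j.val < x.val) := fun j hj hj' => by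
    have := Fin.val_ne_of_ne hj; have := Fin.val_ne_of_ne hj'; omega
  have Rx : ∀ g (b : Fin n → Ω), relabel (y.val + 1) g b x = g (b x) := fun g b => if_pos (by omega)
  have Ry : ∀ g (b : Fin n → Ω), relabel (y.val + 1) g b y = g (b y) := fun g b => if_pos (by omega)
  -- Here `s` and `pHalf` fix the word `a`. The term containing `p` already equals `opL Ω y`; `p L
  -- s` cancels `s L s`, and `s L p` cancels σ.
  by_cases ha : a x = a y
  · have hsw : (fun j => a (Equiv.swap x y j)) = a := by
      refine eq_of_agree_two (x := x) (y := y) (by simp [ha]) (by simp [ha]) fun j hjx hjy => ?_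
      rw [Equiv.swap_apply_of_ne_of_ne hjx hjy]
    have h1 : relabel (x.val + 1) (Equiv.swap (a y) (a x)) a =
        relabel (y.val + 1) (Equiv.swap (a x) (a y)) a := by
      simp [ha, relabel_refl]
    have h2 : ∀ c, Function.update (relabel (x.val + 1) (Equiv.swap (a x) c) a) y c =
        relabel (y.val + 1) (Equiv.swap (a y) c) a := by
      intro c
      refine eq_of_agree_two (x := x) (y := y) (by simp [ha, rx, Rx, hxy]) (by simp [Ry])
        fun j hjx hjy => ?_
      simp [relabel, hjy, lx j hjx, ly j hjx hjy, ha]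
    simp only [if_pos ha, hsw, h1]
    simp only [ha] at h2 ⊢
    simp only [h2, Equiv.swap_self, relabel_refl]
    ring
  -- Now the terms starting with `pHalf` vanish. `s L s` agrees with `opL Ω y` term by term except
  -- at `c = a x`; there `s L p` removes the wrong term and σ supplies the right one.
  · have h1 : relabel (x.val + 1) (Equiv.swap (a y) (a x)) (fun j => a (Equiv.swap x y j)) =
        fun j => relabel (x.val + 1) (Equiv.swap (a y) (a x)) (fun j => a (Equiv.swap x y j))
          (Equiv.swap x y j) := by
      refine eq_of_agree_two (x := x) (y := y) (by simp [rx, ry]) (by simp [rx, ry])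
        fun j hjx hjy => ?_
      rw [Equiv.swap_apply_of_ne_of_ne hjx hjy]
    have h2 : ∀ c, c ≠ a x → (fun j => relabel (x.val + 1) (Equiv.swap (a y) c)
        (fun j => a (Equiv.swap x y j)) (Equiv.swap x y j)) =
          relabel (y.val + 1) (Equiv.swap (a y) c) a := by
      intro c hc
      refine eq_of_agree_two (x := x) (y := y) ?_ ?_ fun j hjx hjy => ?_
      · simp [Rx, ry, Equiv.swap_apply_of_ne_of_ne ha hc.symm]
      · simp [Ry, rx]
      · simp [relabel, Equiv.swap_apply_of_ne_of_ne hjx hjy, lx j hjx, ly j hjx hjy]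
    have h3 : ∑ c, ((f fun j => relabel (x.val + 1) (Equiv.swap (a y) c)
        (fun j => a (Equiv.swap x y j)) (Equiv.swap x y j)) -
          f (relabel (y.val + 1) (Equiv.swap (a y) c) a)) =
        f (relabel (x.val + 1) (Equiv.swap (a y) (a x)) fun j => a (Equiv.swap x y j)) -
          f (relabel (y.val + 1) (Equiv.swap (a y) (a x)) a) := by
      rw [Finset.sum_eq_single (a x), ← h1]
      · intro c _ hc
        rw [h2 c hc, sub_self]
      · simp
    rw [Finset.sum_sub_distrib] at h3
    simp only [if_neg ha, Equiv.swap_comm (a x) (a y)]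
    linarith

theorem LHalf_step {i : ℕ} {x y : Fin n} (hx : x.val = i) (hy : y.val = i + 1)
    (hL : action n Ω (L n (i + 1)) = opL Ω x) (hL' : action n Ω (LHalf n i) = opLHalf Ω x)
    (hs : action n Ω (sigmaHalf n (i + 1)) = opSigmaHalf Ω x y) :
    action n Ω (LHalf n (i + 1)) = opLHalf Ω y := by
  refine LinearMap.ext fun f => funext fun a => ?_
  have hxy : x ≠ y := fun h => by rw [h] at hx; omega
  have hyx := hxy.symm
  rw [LHalf]
  simp only [map_add, map_sub, map_neg, map_mul, hL, hL', hs, LinearMap.add_apply,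
    LinearMap.sub_apply, LinearMap.neg_apply, Module.End.mul_apply, Pi.add_apply, Pi.sub_apply,
    Pi.neg_apply, action_s_apply hx hy, action_pHalf_apply hx hy, opL_apply, opLHalf_apply,
    opSigmaHalf_apply, action_p_apply hx]
  have rx : ∀ g (b : Fin n → Ω), relabel (x.val + 1) g b x = g (b x) := fun g b => if_pos (by omega)
  have ry : ∀ g (b : Fin n → Ω), relabel (x.val + 1) g b y = b y := fun g b => if_neg (by omega)
  simp only [rx, ry, Equiv.swap_apply_left, Function.update_self,
    Function.update_of_ne hyx, Finset.sum_ite_eq', Finset.mem_univ, if_true]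
  have ly : ∀ j : Fin n, j ≠ x → (j.val < y.val ↔ j.val < x.val) := fun j hj => by
    have := Fin.val_ne_of_ne hj; omega
  have Rx : ∀ g (b : Fin n → Ω), relabel y.val g b x = g (b x) := fun g b => if_pos (by omega)
  have Ry : ∀ g (b : Fin n → Ω), relabel y.val g b y = b y := fun g b => if_neg (by omega)
  have Qx : ∀ g (b : Fin n → Ω), relabel x.val g b x = b x := fun g b => if_neg (by omega)
  have Qy : ∀ g (b : Fin n → Ω), relabel x.val g b y = b y := fun g b => if_neg (by omega)
  have h0 : ∀ c, (fun j => relabel x.val (Equiv.swap (a y) c) (fun j => a (Equiv.swap x y j))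
      (Equiv.swap x y j)) = relabel x.val (Equiv.swap (a y) c) a := by
    intro c
    refine eq_of_agree_two (x := x) (y := y) (by simp [Qx, Qy]) (by simp [Qx, Qy])
      fun j hjx hjy => ?_
    simp [relabel, Equiv.swap_apply_of_ne_of_ne hjx hjy]
  have hyx' : x.val + 1 = y.val := by omega
  simp only [h0, Equiv.swap_apply_self, Finset.sum_sub_distrib, hyx']
  -- If the letters agree, `p L` gives the sum of relabelled values in `opLHalf Ω y`, the term
  -- containing `p` cancels the relabelled part of `s L s`, and `L p` cancels σ. Otherwise only `L
  -- p`, `s L s` and σ survive: relabelling `x.val` or `y.val` positions differs only at position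
  -- `x`, hence only for `c = a x`, and `L p` and σ correct that term.
  by_cases ha : a x = a y
  · have h1 : relabel y.val (Equiv.swap (a x) (a y)) a = a := by
      simp [ha, relabel_refl]
    have h1' : relabel x.val (Equiv.swap (a x) (a y)) a = a := by
      simp [ha, relabel_refl]
    have h2 : ∀ c, Function.update (relabel y.val (Equiv.swap (a x) c) a) x (a y) =
        relabel x.val (Equiv.swap (a y) c) a := by
      intro c
      refine eq_of_agree_two (x := x) (y := y) (by simp [ha, Qx]) (by simp [Ry, Qy, hyx])
        fun j hjx hjy => ?_
      simp [relabel, hjx, ly j hjx, ha]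
    simp only [if_pos ha, h1, h1', h2]
    simp only [ha]
    ring
  · have h2 : ∀ c, c ≠ a x → relabel x.val (Equiv.swap (a y) c) a =
          relabel y.val (Equiv.swap (a y) c) a := by
      intro c hc
      refine eq_of_agree_two (x := x) (y := y) ?_ ?_ fun j hjx hjy => ?_
      · simp [Rx, Qx, Equiv.swap_apply_of_ne_of_ne ha hc.symm]
      · simp [Ry, Qy]
      · simp [relabel, ly j hjx]
    have h3 : ∑ c, (f (relabel x.val (Equiv.swap (a y) c) a) -
          f (relabel y.val (Equiv.swap (a y) c) a)) =
        f (relabel x.val (Equiv.swap (a y) (a x)) a) -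
          f (relabel y.val (Equiv.swap (a y) (a x)) a) := by
      rw [Finset.sum_eq_single (a x)]
      · intro c _ hc
        rw [h2 c hc, sub_self]
      · simp
    rw [Finset.sum_sub_distrib] at h3
    simp only [if_neg ha, Equiv.swap_comm (a x) (a y)]
    linarith

/-- The conjugate of the previous σ gives the desired word, except that position `x` keeps its
letter `a x`. This is wrong only if exactly one of `a y`, `a z` equals `a x`. The other four terms
form two pairs, desired word minus uncorrected word, active when `a x = a z` and when `a x = a y`
respectively. If both are active, all five words coincide and the signs add up to 1. -/
theorem sigma_step {i : ℕ} {x y z : Fin n} (hx : x.val = i) (hy : y.val = i + 1)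
    (hz : z.val = i + 2)
    (hL : action n Ω (L n (i + 1)) = opL Ω x)
    (hs : action n Ω (sigmaSucc n (i + 1)) = opSigma Ω x y) :
    action n Ω (sigmaSucc n (i + 2)) = opSigma Ω y z := by
  have hp : ∀ (f : (Fin n → Ω) → ℤ) a, action n Ω (p n (i + 2)) f a =
    ∑ c, f (Function.update a y c) := action_p_apply hy
  have hs2 : ∀ (f : (Fin n → Ω) → ℤ) a, action n Ω (s n (i + 2)) f a =
    f (fun j => a (Equiv.swap y z j)) := action_s_apply hy hz
  have hh2 : ∀ (f : (Fin n → Ω) → ℤ) a, action n Ω (pHalf n (i + 2)) f a =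
    if a y = a z then f a else 0 := action_pHalf_apply hy hz
  refine LinearMap.ext fun f => funext fun a => ?_
  have hxy : x ≠ y := fun h => by rw [h] at hx; omega
  have hxz : x ≠ z := fun h => by rw [h] at hx; omega
  have hyz : y ≠ z := fun h => by rw [h] at hy; omega
  rw [sigmaSucc]
  simp only [map_add, map_sub, map_mul, hL, hs, LinearMap.add_apply,
    LinearMap.sub_apply, Module.End.mul_apply, Pi.add_apply, Pi.sub_apply,
    action_s_apply hx hy, action_pHalf_apply hx hy, opL_apply, opSigma_apply, hp,
    hs2, hh2]
  have rx : ∀ g (b : Fin n → Ω), relabel (x.val + 1) g b x = g (b x) := fun g b => if_pos (by omega)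
  have ry : ∀ g (b : Fin n → Ω), relabel (x.val + 1) g b y = b y := fun g b => if_neg (by omega)
  have rz : ∀ g (b : Fin n → Ω), relabel (x.val + 1) g b z = b z := fun g b => if_neg (by omega)
  simp only [rx, ry, rz, Equiv.swap_apply_left, Equiv.swap_apply_right, Function.update_self,
    Equiv.swap_apply_of_ne_of_ne hxy hxz, Equiv.swap_apply_of_ne_of_ne hxz.symm hyz.symm,
    Function.update_of_ne hxy, Function.update_of_ne hyz.symm, Finset.sum_ite_eq,
    Finset.sum_ite_eq', Finset.mem_univ, if_true]
  have lx : ∀ j : Fin n, j ≠ x → (j.val < x.val + 1 ↔ j.val < x.val) := fun j hj => by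
    have := Fin.val_ne_of_ne hj; omega
  have lx' : ∀ j : Fin n, j ≠ x → (j ≤ x ↔ j < x) := fun j hj => hj.le_iff_lt
  have ly : ∀ j : Fin n, j ≠ x → j ≠ y → (j.val < y.val + 1 ↔ j.val < x.val) := fun j hj hj' => by
    have := Fin.val_ne_of_ne hj; have := Fin.val_ne_of_ne hj'; omega
  have lz : ∀ j : Fin n, j ≠ x → j ≠ y → j ≠ z → (j.val < z.val + 1 ↔ j.val < x.val) :=
    fun j hj hj' hj'' => by
      have := Fin.val_ne_of_ne hj; have := Fin.val_ne_of_ne hj'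
      have := Fin.val_ne_of_ne hj''; omega
  have Rx : ∀ g (b : Fin n → Ω), relabel (y.val + 1) g b x = g (b x) := fun g b => if_pos (by omega)
  have Ry : ∀ g (b : Fin n → Ω), relabel (y.val + 1) g b y = g (b y) := fun g b => if_pos (by omega)
  have Rz : ∀ g (b : Fin n → Ω), relabel (y.val + 1) g b z = b z := fun g b => if_neg (by omega)
  have Sx : ∀ g (b : Fin n → Ω), relabel (z.val + 1) g b x = g (b x) := fun g b => if_pos (by omega)
  have Sy : ∀ g (b : Fin n → Ω), relabel (z.val + 1) g b y = g (b y) := fun g b => if_pos (by omega)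
  have Sz : ∀ g (b : Fin n → Ω), relabel (z.val + 1) g b z = g (b z) := fun g b => if_pos (by omega)
  have sx : Equiv.swap y z x = x := Equiv.swap_apply_of_ne_of_ne hxy hxz
  have sz : Equiv.swap x y z = z := Equiv.swap_apply_of_ne_of_ne hxz.symm hyz.symm
  have h1 : (fun j => relabel (y.val + 1) (Equiv.swap (a y) (a z))
      (fun j => a (Equiv.swap x y (Equiv.swap y z j))) (Equiv.swap y z (Equiv.swap x y j))) =
      Function.update (relabel (z.val + 1) (Equiv.swap (a y) (a z)) a) x (a x) := by
    refine eq_of_agree_three (x := x) (y := y) (z := z) ?_ ?_ ?_ fun j hjx hjy hjz => ?_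
    · simp [Rz]
    · simp [Rx, Sy, sx, hxy.symm]
    · simp [Ry, Sz, sz, hxz.symm]
    · simp [relabel, Equiv.swap_apply_of_ne_of_ne, hjx, hjy, hjz, ly, lz]
  have h2 : a x = a z → (fun j => relabel (x.val + 1) (Equiv.swap (a x) (a y))
      (fun j => a (Equiv.swap y z j)) j) = relabel (z.val + 1) (Equiv.swap (a y) (a z)) a := by
    intro h
    refine eq_of_agree_three (x := x) (y := y) (z := z) ?_ ?_ ?_ fun j hjx hjy hjz => ?_
    · simp [rx, Sx, sx, h]
    · simp [ry, Sy]
    · simp [rz, Sz]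
    · simp [relabel, Equiv.swap_apply_of_ne_of_ne, hjx, hjy, hjz, lx, lz, h,
        Equiv.swap_comm (a y)]
  have h3 : a x = a y → (fun j => relabel (x.val + 1) (Equiv.swap (a x) (a z)) a
      (Equiv.swap y z j)) = relabel (z.val + 1) (Equiv.swap (a y) (a z)) a := by
    intro h
    refine eq_of_agree_three (x := x) (y := y) (z := z) ?_ ?_ ?_ fun j hjx hjy hjz => ?_
    · simp [rx, Sx, sx, h]
    · simp [rz, Sy]
    · simp [ry, Sz]
    · simp [relabel, Equiv.swap_apply_of_ne_of_ne, hjx, hjy, hjz, lx, lz, h]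
  have h4 : a x = a z → Function.update (fun j => relabel (x.val + 1) (Equiv.swap (a x) (a y))
      (fun j => a (Equiv.swap y z j)) (Equiv.swap x y j)) y (a z) =
      Function.update (relabel (z.val + 1) (Equiv.swap (a y) (a z)) a) x (a x) := by
    intro h
    refine eq_of_agree_three (x := x) (y := y) (z := z) ?_ ?_ ?_ fun j hjx hjy hjz => ?_
    · simp [ry, hxy, h]
    · simp [Sy, hxy.symm]
    · simp [rz, Sz, sz, hyz.symm, hxz.symm]
    · simp [relabel, Equiv.swap_apply_of_ne_of_ne, hjx, hjy, hjz, lx', lz, h,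
        Equiv.swap_comm (a y)]
  have h5 : a x = a y → (fun j => relabel (x.val + 1) (Equiv.swap (a z) (a x))
      (fun j => Function.update a y (a z) (Equiv.swap x y j)) (Equiv.swap y z j)) =
      Function.update (relabel (z.val + 1) (Equiv.swap (a y) (a z)) a) x (a x) := by
    intro h
    refine eq_of_agree_three (x := x) (y := y) (z := z) ?_ ?_ ?_ fun j hjx hjy hjz => ?_
    · simp [rx, sx]
    · simp [rz, sz, Sy, hxy.symm, hyz.symm]
    · simp [ry, Sz, h, hxz.symm, hxy]
    · simp [relabel, Equiv.swap_apply_of_ne_of_ne, hjx, hjy, hjz, lx, lz, h,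
        Equiv.swap_comm (a y)]
  -- The transposition of `a y` and `a z` fixes `a x` if both letters equal `a x` or neither does.
  have h6 : (a x = a y ↔ a x = a z) →
      Function.update (relabel (z.val + 1) (Equiv.swap (a y) (a z)) a) x (a x) =
        relabel (z.val + 1) (Equiv.swap (a y) (a z)) a := by
    intro h
    rw [Function.update_eq_self_iff, Sx]
    by_cases hay : a x = a y
    · rw [← hay, ← h.1 hay, Equiv.swap_self, Equiv.refl_apply]
    · rw [Equiv.swap_apply_of_ne_of_ne hay (mt h.2 hay)]
  rw [h1]
  simp only [Equiv.swap_apply_self]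
  by_cases hay : a x = a y <;> by_cases haz : a x = a z
  · rw [if_pos haz, if_pos hay, if_pos haz, if_pos hay, h2 haz, h3 hay, h4 haz, h5 hay,
      h6 (iff_of_true hay haz)]
    ring
  · rw [if_neg haz, if_pos hay, if_neg haz, if_pos hay, h3 hay, h5 hay]
    ring
  · rw [if_pos haz, if_neg hay, if_pos haz, if_neg hay, h2 haz, h4 haz]
    ring
  · rw [if_neg haz, if_neg hay, if_neg haz, if_neg hay, h6 (iff_of_false hay haz)]
    ring

/-- The cancellation of `sigma_step` recurs: conjugating the previous σ omits the relabelling at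
position `x`, and the two correcting pairs are again active when `a x = a y` and when `a x = a z`.
Positions `y` and `z` now keep their letters. -/
theorem sigmaHalf_step {i : ℕ} {x y z : Fin n} (hx : x.val = i) (hy : y.val = i + 1)
    (hz : z.val = i + 2)
    (hL : action n Ω (L n (i + 1)) = opL Ω x)
    (hs : action n Ω (sigmaHalf n (i + 1)) = opSigmaHalf Ω x y) :
    action n Ω (sigmaHalf n (i + 2)) = opSigmaHalf Ω y z := by
  have hp : ∀ (f : (Fin n → Ω) → ℤ) a, action n Ω (p n (i + 2)) f a =
    ∑ c, f (Function.update a y c) := action_p_apply hy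
  have hs2 : ∀ (f : (Fin n → Ω) → ℤ) a, action n Ω (s n (i + 2)) f a =
    f (fun j => a (Equiv.swap y z j)) := action_s_apply hy hz
  have hh2 : ∀ (f : (Fin n → Ω) → ℤ) a, action n Ω (pHalf n (i + 2)) f a =
    if a y = a z then f a else 0 := action_pHalf_apply hy hz
  refine LinearMap.ext fun f => funext fun a => ?_
  have hxy : x ≠ y := fun h => by rw [h] at hx; omega
  have hxz : x ≠ z := fun h => by rw [h] at hx; omega
  have hyz : y ≠ z := fun h => by rw [h] at hy; omega
  rw [sigmaHalf]
  simp only [map_add, map_sub, map_mul, hL, hs, LinearMap.add_apply,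
    LinearMap.sub_apply, Module.End.mul_apply, Pi.add_apply, Pi.sub_apply,
    action_s_apply hx hy, action_pHalf_apply hx hy, opL_apply, opSigmaHalf_apply, hp,
    hs2, hh2]
  have rx : ∀ g (b : Fin n → Ω), relabel (x.val + 1) g b x = g (b x) := fun g b => if_pos (by omega)
  have ry : ∀ g (b : Fin n → Ω), relabel (x.val + 1) g b y = b y := fun g b => if_neg (by omega)
  have rz : ∀ g (b : Fin n → Ω), relabel (x.val + 1) g b z = b z := fun g b => if_neg (by omega)
  simp only [rx, ry, rz, Equiv.swap_apply_left, Equiv.swap_apply_right, Function.update_self,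
    Equiv.swap_apply_of_ne_of_ne hxy hxz, Equiv.swap_apply_of_ne_of_ne hxz.symm hyz.symm,
    Function.update_of_ne hxy, Function.update_of_ne hyz.symm, Finset.sum_ite_eq,
    Finset.sum_ite_eq', Finset.mem_univ, if_true]
  have lx : ∀ j : Fin n, j ≠ x → (j.val < x.val + 1 ↔ j.val < x.val) := fun j hj => by
    have := Fin.val_ne_of_ne hj; omega
  have lx' : ∀ j : Fin n, j ≠ x → (j ≤ x ↔ j < x) := fun j hj => hj.le_iff_lt
  have ly : ∀ j : Fin n, j ≠ x → (j.val < y.val ↔ j.val < x.val) := fun j hj => by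
    have := Fin.val_ne_of_ne hj; omega
  have Qx : ∀ g (b : Fin n → Ω), relabel x.val g b x = b x := fun g b => if_neg (by omega)
  have Qy : ∀ g (b : Fin n → Ω), relabel x.val g b y = b y := fun g b => if_neg (by omega)
  have Qz : ∀ g (b : Fin n → Ω), relabel x.val g b z = b z := fun g b => if_neg (by omega)
  have Rx : ∀ g (b : Fin n → Ω), relabel y.val g b x = g (b x) := fun g b => if_pos (by omega)
  have Ry : ∀ g (b : Fin n → Ω), relabel y.val g b y = b y := fun g b => if_neg (by omega)
  have Rz : ∀ g (b : Fin n → Ω), relabel y.val g b z = b z := fun g b => if_neg (by omega)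
  have sx : Equiv.swap y z x = x := Equiv.swap_apply_of_ne_of_ne hxy hxz
  have sz : Equiv.swap x y z = z := Equiv.swap_apply_of_ne_of_ne hxz.symm hyz.symm
  have h1 : (fun j => relabel x.val (Equiv.swap (a y) (a z))
      (fun j => a (Equiv.swap x y (Equiv.swap y z j))) (Equiv.swap y z (Equiv.swap x y j))) =
      Function.update (relabel y.val (Equiv.swap (a y) (a z)) a) x (a x) := by
    refine eq_of_agree_three (x := x) (y := y) (z := z) ?_ ?_ ?_ fun j hjx hjy hjz => ?_
    · simp [Qz]
    · simp [Qx, Ry, sx, hxy.symm]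
    · simp [Qy, Rz, sz, hxz.symm]
    · simp [relabel, Equiv.swap_apply_of_ne_of_ne, hjx, hjy, hjz, ly]
  have h2 : a x = a y → (fun j => relabel (x.val + 1) (Equiv.swap (a x) (a z)) a j) =
      relabel y.val (Equiv.swap (a y) (a z)) a := by
    intro h
    refine eq_of_agree_three (x := x) (y := y) (z := z) ?_ ?_ ?_ fun j hjx hjy hjz => ?_
    · simp [rx, Rx, h]
    · simp [ry, Ry]
    · simp [rz, Rz]
    · simp [relabel, hjx, lx, ly, h]
  have h3 : a x = a z → (fun j => relabel (x.val + 1) (Equiv.swap (a x) (a y))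
      (fun j => a (Equiv.swap y z j)) (Equiv.swap y z j)) =
      relabel y.val (Equiv.swap (a y) (a z)) a := by
    intro h
    refine eq_of_agree_three (x := x) (y := y) (z := z) ?_ ?_ ?_ fun j hjx hjy hjz => ?_
    · simp [rx, Rx, sx, h]
    · simp [rz, Ry]
    · simp [ry, Rz]
    · simp [relabel, Equiv.swap_apply_of_ne_of_ne, hjx, hjy, hjz, lx, ly, h,
        Equiv.swap_comm (a y)]
  have h4 : a x = a y → Function.update (fun j => relabel (x.val + 1) (Equiv.swap (a x) (a z)) a
      (Equiv.swap x y j)) y (a y) =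
      Function.update (relabel y.val (Equiv.swap (a y) (a z)) a) x (a x) := by
    intro h
    refine eq_of_agree_three (x := x) (y := y) (z := z) ?_ ?_ ?_ fun j hjx hjy hjz => ?_
    · simp [ry, hxy, h]
    · simp [Ry, hxy.symm]
    · simp [rz, Rz, sz, hyz.symm, hxz.symm]
    · simp [relabel, Equiv.swap_apply_of_ne_of_ne, hjx, hjy, lx', ly, h]
  have h5 : a x = a z → (fun j => relabel (x.val + 1) (Equiv.swap (a y) (a x))
      (fun j => Function.update (fun j => a (Equiv.swap y z j)) y (a y) (Equiv.swap x y j))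
        (Equiv.swap y z j)) =
      Function.update (relabel y.val (Equiv.swap (a y) (a z)) a) x (a x) := by
    intro h
    refine eq_of_agree_three (x := x) (y := y) (z := z) ?_ ?_ ?_ fun j hjx hjy hjz => ?_
    · simp [rx, sx]
    · simp [rz, sz, Ry, hxy.symm, hyz.symm]
    · simp [ry, Rz, sx, h, hxz.symm, hxy]
    · simp [relabel, Equiv.swap_apply_of_ne_of_ne, hjx, hjy, hjz, lx, ly, h]
  have h6 : (a x = a y ↔ a x = a z) →
      Function.update (relabel y.val (Equiv.swap (a y) (a z)) a) x (a x) =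
        relabel y.val (Equiv.swap (a y) (a z)) a := by
    intro h
    rw [Function.update_eq_self_iff, Rx]
    by_cases hay : a x = a y
    · rw [← hay, ← h.1 hay, Equiv.swap_self, Equiv.refl_apply]
    · rw [Equiv.swap_apply_of_ne_of_ne hay (mt h.2 hay)]
  rw [h1]
  simp only [Equiv.swap_apply_self]
  by_cases hay : a x = a y <;> by_cases haz : a x = a z
  · rw [if_pos hay, if_pos haz, if_pos hay, if_pos haz, h2 hay, h3 haz, h4 hay, h5 haz,
      h6 (iff_of_true hay haz)]
    ring
  · rw [if_pos hay, if_neg haz, if_pos hay, if_neg haz, h2 hay, h4 hay]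
    ring
  · rw [if_neg hay, if_pos haz, if_neg hay, if_pos haz, h3 haz, h5 haz]
    ring
  · rw [if_neg hay, if_neg haz, if_neg hay, if_neg haz, h6 (iff_of_false hay haz)]
    ring

/-- L and σ with integer indices feed into each other's recursion, so both formulas go through one
induction. The half-integer families use the integer L's but not conversely, and can follow
separately. -/
theorem action_L_and_sigma (i : ℕ) :
    (∀ x : Fin n, x.val = i → action n Ω (L n (i + 1)) = opL Ω x) ∧
      ∀ x y : Fin n, x.val = i → y.val = i + 1 →
        action n Ω (sigmaSucc n (i + 1)) = opSigma Ω x y := by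
  induction i with
  | zero =>
    refine ⟨fun x hx => ?_, fun x y hx hy => ?_⟩ <;>
      refine LinearMap.ext fun f => funext fun a => ?_
    · rw [L, action_p_apply hx, opL_apply]
      refine Finset.sum_congr rfl fun c _ => congrArg f (funext fun j => ?_)
      by_cases hj : j = x
      · rw [hj, relabel, if_pos (Nat.lt_succ_self _), Function.update_self, Equiv.swap_apply_left]
      · have := Fin.val_ne_of_ne hj
        rw [relabel, if_neg (by omega), Function.update_of_ne hj]
    · rw [sigmaSucc, action_s_apply hx hy, opSigma_apply]
      congr 1
      refine eq_of_agree_two (x := x) (y := y) ?_ ?_ fun j hjx hjy => ?_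
      · rw [relabel, if_pos (by omega), Equiv.swap_apply_left, Equiv.swap_apply_left]
      · rw [relabel, if_pos (by omega), Equiv.swap_apply_right, Equiv.swap_apply_right]
      · have := Fin.val_ne_of_ne hjx
        have := Fin.val_ne_of_ne hjy
        rw [relabel, if_neg (by omega), Equiv.swap_apply_of_ne_of_ne hjx hjy]
  | succ i ih =>
    refine ⟨fun y hy => ?_, fun y z hy hz => ?_⟩
    · let x : Fin n := ⟨i, by omega⟩
      exact L_step (x := x) rfl hy (ih.1 x rfl) (ih.2 x y rfl hy)
    · let x : Fin n := ⟨i, by omega⟩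
      exact sigma_step (x := x) rfl hy hz (ih.1 x rfl) (ih.2 x y rfl hy)

theorem action_L {i : ℕ} {x : Fin n} (hx : x.val = i) :
    action n Ω (L n (i + 1)) = opL Ω x :=
  (action_L_and_sigma i).1 x hx

theorem action_sigma {i : ℕ} {x y : Fin n} (hx : x.val = i) (hy : y.val = i + 1) :
    action n Ω (sigma n (i + 2)) = opSigma Ω x y :=
  (action_L_and_sigma i).2 x y hx hy

theorem action_sigmaHalf {i : ℕ} {x y : Fin n} (hx : x.val = i) (hy : y.val = i + 1) :
    action n Ω (sigmaHalf n (i + 1)) = opSigmaHalf Ω x y := by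
  induction i generalizing x y with
  | zero =>
    refine LinearMap.ext fun f => funext fun a => ?_
    -- The closed formula relabels the first 0 positions, which is the identity.
    rw [sigmaHalf, map_one, opSigmaHalf_apply, hx, relabel_zero, Module.End.one_apply]
  | succ i ih =>
    let w : Fin n := ⟨i, by omega⟩
    exact sigmaHalf_step (x := w) rfl hx hy (action_L rfl) (ih rfl hx)

theorem action_LHalf {i : ℕ} {y : Fin n} (hy : y.val = i) :
    action n Ω (LHalf n i) = opLHalf Ω y := by
  induction i generalizing y with
  | zero =>
    refine LinearMap.ext fun f => funext fun a => ?_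
    simp [LHalf, opLHalf_apply, hy, relabel_zero]
  | succ i ih =>
    let x : Fin n := ⟨i, by omega⟩
    exact LHalf_step (x := x) rfl hy (action_L rfl) (ih rfl) (action_sigmaHalf rfl hy)

end Recursion

-- Transfer back to the partition algebra

section Main

variable {n : ℕ}

theorem commute_L_L {i j : ℕ} (hi : i ≤ n) (hj : j ≤ n) : Commute (L n i) (L n j) := by
  wlog hij : i ≤ j generalizing i j
  · exact (this hj hi (Nat.le_of_not_le hij)).symm
  rcases hij.eq_or_lt with rfl | hij
  · exact Commute.refl _
  obtain _ | i := i
  · rw [L]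
    exact Commute.zero_left _
  obtain _ | j := j
  · omega
  refine commute_of_action fun N => ?_
  rw [action_L (x := ⟨i, hi⟩) rfl, action_L (x := ⟨j, hj⟩) rfl]
  exact (commute_opL_opL (Fin.lt_def.2 (Nat.lt_of_succ_lt_succ hij))).symm

theorem commute_L_LHalf {i j : ℕ} (hi : i ≤ n) (hj : j + 1 ≤ n) :
    Commute (L n i) (LHalf n j) := by
  obtain _ | i := i
  · rw [L]
    exact Commute.zero_left _
  refine commute_of_action fun N => ?_
  rw [action_L (x := ⟨i, hi⟩) rfl, action_LHalf (y := ⟨j, hj⟩) rfl]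
  -- `LHalf n j` stands for L_{j+1/2}, which precedes L_{i+1} exactly when `j ≤ i`; the operator
  -- with the larger index is expanded into cuts and relabellings.
  rcases le_or_gt j i with h | h
  · exact commute_opL_opLHalf (Fin.le_def.2 h)
  · exact (commute_opLHalf_opL (Fin.lt_def.2 h)).symm

theorem commute_LHalf_LHalf {i j : ℕ} (hi : i + 1 ≤ n) (hj : j + 1 ≤ n) :
    Commute (LHalf n i) (LHalf n j) := by
  refine commute_of_action fun N => ?_
  rw [action_LHalf (y := ⟨i, hi⟩) rfl, action_LHalf (y := ⟨j, hj⟩) rfl]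
  rcases lt_trichotomy i j with h | rfl | h
  · exact (commute_opLHalf_opLHalf (Fin.lt_def.2 h)).symm
  · exact Commute.refl _
  · exact commute_opLHalf_opLHalf (Fin.lt_def.2 h)

/-- In a diagram of `A_{m + 1/2}`, the vertices `j` and `j'` are in the same block for `j > m`. -/
theorem extend_rel_of_half {m : ℕ} {d : Diagram (m + 1)}
    (hd : d (Sum.inl (Fin.last m)) (Sum.inr (Fin.last m))) {j : Fin n} (hj : m ≤ j.val) :
    d.extend n (Sum.inl j) (Sum.inr j) := by
  rcases hj.eq_or_lt with h | h
  · rw [Setoid.ker_def]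
    have hj' : j.val < m + 1 := by omega
    have hl : (⟨j.val, hj'⟩ : Fin (m + 1)) = Fin.last m := Fin.ext h.symm
    simp only [Sum.elim_inl, Sum.elim_inr, dif_pos hj', hl]
    exact congrArg Sum.inl (Quotient.sound hd)
  · exact d.extend_rel_of_le h

theorem commute_L_of_mem_subalgHalf {i : ℕ} (hi : i + 1 ≤ n) :
    ∀ a ∈ subalgHalf n i, Commute (L n (i + 1)) a := by
  refine commute_of_mem_adjoin ?_
  rintro _ ⟨d, hd, rfl⟩
  refine commute_of_action fun N => ?_
  rw [action_L (x := ⟨i, hi⟩) rfl, action_ofDiagram]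
  exact commute_opL (fun v => cut_commute_diagramAction (extend_rel_of_half hd le_rfl) v)
    (relabelOp_commute_diagramAction le_rfl d)

theorem commute_sigma_of_mem_subalgHalf {i : ℕ} (hi : i + 2 ≤ n) :
    ∀ a ∈ subalgHalf n i, Commute (sigma n (i + 2)) a := by
  refine commute_of_mem_adjoin ?_
  rintro _ ⟨d, hd, rfl⟩
  refine commute_of_action fun N => ?_
  rw [action_sigma (x := ⟨i, by omega⟩) (y := ⟨i + 1, hi⟩) rfl rfl, action_ofDiagram]
  -- σ reads the letters at positions `i` and `i + 1`: the first is joined to its partner by the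
  -- half-integer condition, the second by the block added in the extension.
  exact commute_opSigma (fun v => cut_commute_diagramAction (extend_rel_of_half hd le_rfl) v)
    (fun v => cut_commute_diagramAction (extend_rel_of_half hd (Nat.le_succ i)) v)
    (relabelOp_commute_diagramAction (Nat.le_succ _) d)

theorem commute_LHalf_of_mem_subalg {i : ℕ} (hi : i + 1 ≤ n) :
    ∀ a ∈ subalg n i, Commute (LHalf n i) a := by
  refine commute_of_mem_adjoin ?_
  rintro _ ⟨d, rfl⟩
  refine commute_of_action fun N => ?_
  rw [action_LHalf (y := ⟨i, hi⟩) rfl, action_ofDiagram]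
  exact commute_opLHalf (fun v => cut_commute_diagramAction (d.extend_rel_of_le le_rfl) v)
    (relabelOp_commute_diagramAction le_rfl d)

theorem commute_sigmaHalf_of_mem_subalg {i : ℕ} (hi : i + 2 ≤ n) :
    ∀ a ∈ subalg n i, Commute (sigmaHalf n (i + 1)) a := by
  refine commute_of_mem_adjoin ?_
  rintro _ ⟨d, rfl⟩
  refine commute_of_action fun N => ?_
  rw [action_sigmaHalf (x := ⟨i, by omega⟩) (y := ⟨i + 1, hi⟩) rfl rfl, action_ofDiagram]
  exact commute_opSigmaHalf (fun v => cut_commute_diagramAction (d.extend_rel_of_le le_rfl) v)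
    (fun v => cut_commute_diagramAction (d.extend_rel_of_le (Nat.le_succ i)) v)
    (relabelOp_commute_diagramAction le_rfl d)

end Main

end PartitionAlg

theorem mainTheorem3 :
    (∀ n i : ℕ, 1 ≤ i → i + 1 ≤ n →
      ((∀ a ∈ PartitionAlg.subalgHalf n i, Commute (PartitionAlg.L n (i + 1)) a) ∧
        (∀ a ∈ PartitionAlg.subalgHalf n (i - 1), Commute (PartitionAlg.sigma n (i + 1)) a)) ∧
      ((∀ a ∈ PartitionAlg.subalg n i, Commute (PartitionAlg.LHalf n i) a) ∧
        (∀ a ∈ PartitionAlg.subalg n (i - 1), Commute (PartitionAlg.sigmaHalf n i) a))) ∧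
    (∀ n i j : ℕ,
      (i ≤ n → j ≤ n → Commute (PartitionAlg.L n i) (PartitionAlg.L n j)) ∧
      (i ≤ n → j + 1 ≤ n → Commute (PartitionAlg.L n i) (PartitionAlg.LHalf n j)) ∧
      (i + 1 ≤ n → j + 1 ≤ n → Commute (PartitionAlg.LHalf n i) (PartitionAlg.LHalf n j))) := by
  refine ⟨fun n i hi hin => ?_, fun n i j => ⟨PartitionAlg.commute_L_L,
    PartitionAlg.commute_L_LHalf, PartitionAlg.commute_LHalf_LHalf⟩⟩
  obtain ⟨i, rfl⟩ := Nat.exists_eq_add_of_le' hi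
  exact ⟨⟨PartitionAlg.commute_L_of_mem_subalgHalf hin,
    PartitionAlg.commute_sigma_of_mem_subalgHalf hin⟩,
    PartitionAlg.commute_LHalf_of_mem_subalg hin,
    PartitionAlg.commute_sigmaHalf_of_mem_subalg hin⟩
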